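/- Let $n\ge 1$ and let $k\in C(\mathbb R^n)\cap L^\infty(\mathbb R^n)$ satisfy $k\ge 0$, $k(0)>0$ and $\int_{\mathbb R^n}k(x)\,dx=1$. Let $\Omega_0\subset\mathbb R^n$ be a smooth bounded domain, $\ell_0>0$ a constant, and let $\gamma_0\in L^\infty(\mathbb R^n)$ satisfy $\gamma_0=-\ell_0$ on $\mathbb R^n\setminus\bar\Omega_0$, $\gamma_0|_{\bar\Omega_0}\ge 0$, $\gamma_0|_{\bar\Omega_0}\not\equiv 0$ and $\gamma_0|_{\bar\Omega_0}\in C(\bar\Omega_0)$. For $d>0$ let $\gamma$ be a classical solution of the nonlocal one-phase Stefan problem $$\gamma_t(t,x)=d\int_{\{y:\gamma(t,y)>0\}}k(x-y)\gamma(t,y)\,dy-d\,\gamma(t,x)\chi_{\{\gamma(t,x)>0\}}\quad(t>0,\ x\in\mathbb R^n),\qquad \gamma(0,x)=\gamma_0(x)\quad(x\in\mathbb R^n),$$ that is, $\gamma(t,\cdot)\in L^\infty(\mathbb R^n)$ for every $t>0$ and, for every $x\in\mathbb R^n$, the function $t\mapsto\gamma(t,x)$ is continuous at $t=0$ and differentiable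 at every $t>0$, and the two equations above hold. Put $\Omega(t)=\{x\in\mathbb R^n:\gamma(t,x)\ge 0\}$ for $t\ge 0$. Then: (i) (Expansion) there is $t_0>0$ such that $\Omega(t)=\Omega(0)$ for $0\le t\le t_0$, and $\Omega(t_1)\subseteq\Omega(t_2)$ whenever $0<t_1<t_2$; (ii) (Boundedness) there is $R>0$, depending only on the kernel $k$ and the initial data $(\Omega_0,\ell_0,\gamma_0)$ and in particular not on $d$ or $t$, such that $\Omega(t)\subseteq B_R(0)$ for all $t>0$. -/

import Mathlib

open MeasureTheory Set Filter Topology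
open scoped ContDiff

noncomputable section

namespace NonlocalStefan

/-- The space `ℝⁿ` with its Euclidean norm and Lebesgue measure. -/
abbrev E (n : ℕ) : Type := EuclideanSpace ℝ (Fin n)

/-- Assumption (K) on the kernel: `k ∈ C(ℝⁿ) ∩ L^∞(ℝⁿ)`, `k ≥ 0`, `k(0) > 0`, `∫ k = 1`.
Integrability of `k` is forced by the last condition, because the Bochner integral of a
non-integrable function is `0`. -/
structure IsKernel {n : ℕ} (k : E n → ℝ) : Prop where
  continuous : Continuous k
  memLp_top : MemLp k ⊤ volume
  nonneg : ∀ x, 0 ≤ k x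
  pos_zero : 0 < k 0
  integral_eq_one : ∫ x, k x = 1

/-- A smooth bounded domain: a nonempty, connected, bounded open set which near each of its
boundary points is the sublevel set `{φ < 0}` of a `C^∞` function with nonvanishing differential
at that point. -/
structure IsSmoothBoundedDomain {n : ℕ} (Ω : Set (E n)) : Prop where
  isOpen : IsOpen Ω
  isConnected : IsConnected Ω
  isBounded : Bornology.IsBounded Ω
  smooth_boundary : ∀ p ∈ frontier Ω, ∃ (U : Set (E n)) (φ : E n → ℝ),
    IsOpen U ∧ p ∈ U ∧ ContDiffOn ℝ ∞ φ U ∧ fderiv ℝ φ p ≠ 0 ∧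
      ∀ x ∈ U, x ∈ Ω ↔ φ x < 0

/-- One-phase initial data: `γ₀ ∈ L^∞`, `γ₀ = -ℓ₀` off the closure of `Ω₀`, and on the closure of
`Ω₀` it is nonnegative and not identically zero. -/
structure IsOnePhaseInitialData {n : ℕ} (Ω₀ : Set (E n)) (ℓ₀ : ℝ) (γ₀ : E n → ℝ) : Prop where
  memLp_top : MemLp γ₀ ⊤ volume
  eq_outside : ∀ x, x ∉ closure Ω₀ → γ₀ x = -ℓ₀
  nonneg_inside : ∀ x ∈ closure Ω₀, 0 ≤ γ₀ x
  not_identically_zero : ∃ x ∈ closure Ω₀, γ₀ x ≠ 0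

/-- `γ` is a (global, classical) solution of the nonlocal one-phase Stefan problem
`γ_t(t,x) = d ∫_{γ(t,·)>0} k(x-y) γ(t,y) dy - d γ(t,x) χ_{γ(t,x)>0}` for `t > 0`, `x ∈ ℝⁿ`,
`γ(0,x) = γ₀(x)`, with `γ(t,·) ∈ L^∞(ℝⁿ)`. Only the values of `γ` at times `t ≥ 0` matter. -/
structure IsSolution {n : ℕ} (d : ℝ) (k γ₀ : E n → ℝ) (γ : ℝ → E n → ℝ) : Prop where
  memLp_top : ∀ t, 0 < t → MemLp (γ t) ⊤ volume
  initial : ∀ x, γ 0 x = γ₀ x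
  continuous_zero : ∀ x, ContinuousWithinAt (fun s => γ s x) (Ici 0) 0
  equation : ∀ t, 0 < t → ∀ x,
    HasDerivAt (fun s => γ s x)
      (d * (∫ y in {y | 0 < γ t y}, k (x - y) * γ t y)
        - d * indicator {y | 0 < γ t y} (γ t) x) t

/-- `Ω(t) = {x ∈ ℝⁿ | γ(t,x) ≥ 0}`. -/
def region {n : ℕ} (γ : ℝ → E n → ℝ) (t : ℝ) : Set (E n) := {x | 0 ≤ γ t x}

end NonlocalStefan

end

/-!
Let `w = d ∫₀ᵗ γ⁺ ds` be the heat released up to time `t`. Integrating the equation in time gives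
`γ = γ₀ + k ⋆ w - w`, with `γ > 0` wherever `w > 0`. As `e^{dt} γ⁺` is nondecreasing in `t`,
`w ≤ θ (γ₀⁺ + k ⋆ w)` with `θ = 1 - e^{-dt} < 1`, and iterating this shows `w ∈ L¹`.

Every bound from here on is independent of `d` and `t`. Since `∫ (k ⋆ w - w) = 0` while
`k ⋆ w - w ≥ ℓ` on `{w > 0}` away from the initial region `D`, the set `{w > 0}` has bounded
measure. On functions with support of bounded measure, `1 - k⋆` has a spectral gap in `L²`, and
`∫ w (w - k ⋆ w) ≤ G ∫_D w`, with `G = ‖γ₀‖_∞`, then bounds `‖w‖₂`. Hence among many disjoint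
annuli around `D` some annulus `{s ≤ |x| < s + L}` carries so little of `w` that, beyond it,
`k ⋆ w` is within `ℓ` of `k ⋆ u`, where `u` is the part of `w` beyond the annulus. There `u > 0`
forces `u ≤ k ⋆ w - ℓ < k ⋆ u`, which contradicts `∫ u = ∫ k ⋆ u` unless `u = 0`. So `k ⋆ w < ℓ`
far out, and `γ < 0` there.
-/

open scoped Convolution
open ContinuousLinearMap (mul)

namespace NonlocalStefan

section RealAnalysis

lemma sub_le_sub_of_hasDerivAt_le {f g f' g' : ℝ → ℝ} {a b : ℝ} (hab : a ≤ b)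
    (hf : ContinuousOn f (Icc a b)) (hg : ContinuousOn g (Icc a b))
    (hf' : ∀ x ∈ Ioo a b, HasDerivAt f (f' x) x) (hg' : ∀ x ∈ Ioo a b, HasDerivAt g (g' x) x)
    (hle : ∀ x ∈ Ioo a b, f' x ≤ g' x) : f b - f a ≤ g b - g a := by
  have hmono : MonotoneOn (g - f) (Icc a b) := by
    apply monotoneOn_of_deriv_nonneg (convex_Icc a b) (hg.sub hf)
    all_goals rw [interior_Icc]
    · exact fun x hx => ((hg' x hx).sub (hf' x hx)).differentiableAt.differentiableWithinAt
    · intro x hx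
      rw [((hg' x hx).sub (hf' x hx)).deriv]
      exact sub_nonneg.2 (hle x hx)
  have := hmono (left_mem_Icc.2 hab) (right_mem_Icc.2 hab) hab
  simp only [Pi.sub_apply] at this
  linarith

lemma le_of_hasDerivAt_nonneg_of_lt {f f' : ℝ → ℝ} {a b c : ℝ} (hab : a ≤ b)
    (hf : ContinuousOn f (Icc a b)) (hf' : ∀ x ∈ Ioo a b, HasDerivAt f (f' x) x)
    (hnonneg : ∀ x ∈ Ioo a b, f x < c → 0 ≤ f' x) (ha : c ≤ f a) : c ≤ f b := by
  by_contra! hb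
  -- `r` is the last time at which `f = c`; after it `f` cannot decrease.
  obtain ⟨r, ⟨⟨har, hrb⟩, hr⟩, hmax⟩ : ∃ r, IsGreatest (Icc a b ∩ f ⁻¹' {c}) r := by
    refine IsCompact.exists_isGreatest ?_ ?_
    · exact isCompact_Icc.of_isClosed_subset
        (hf.preimage_isClosed_of_isClosed isClosed_Icc isClosed_singleton) inter_subset_left
    · exact intermediate_value_Icc' hab hf ⟨hb.le, ha⟩
  have hlt : ∀ x ∈ Ioo r b, f x < c := by
    intro x hx
    by_contra! hxc
    obtain ⟨y, hy, hyc⟩ := intermediate_value_Icc' hx.2.le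
      (hf.mono (Icc_subset_Icc_left (har.trans hx.1.le))) ⟨hb.le, hxc⟩
    exact (hx.1.trans_le hy.1).not_ge
      (hmax ⟨⟨har.trans (hx.1.le.trans hy.1), hy.2⟩, hyc⟩)
  have := sub_le_sub_of_hasDerivAt_le (f := fun _ => 0) (f' := fun _ => 0) hrb continuousOn_const
    (hf.mono (Icc_subset_Icc_left har)) (fun x _ => hasDerivAt_const x 0)
    (fun x hx => hf' x ⟨har.trans_lt hx.1, hx.2⟩)
    (fun x hx => hnonneg x ⟨har.trans_lt hx.1, hx.2⟩ (hlt x hx))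
  rw [mem_preimage, mem_singleton_iff] at hr
  linarith

end RealAnalysis

section MeasureTheory

variable {α : Type*} [MeasurableSpace α] {μ : Measure α}

lemma ae_abs_le_of_memLp_top {f : α → ℝ} (hf : MemLp f ⊤ μ) :
    ∃ C, 0 ≤ C ∧ ∀ᵐ x ∂μ, |f x| ≤ C := by
  refine ⟨(eLpNorm f ⊤ μ).toReal, ENNReal.toReal_nonneg, ?_⟩
  filter_upwards [ae_le_eLpNormEssSup (f := f) (μ := μ)] with x hx
  rw [← Real.norm_eq_abs, ← toReal_enorm]
  rw [← eLpNorm_exponent_top] at hx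
  exact ENNReal.toReal_mono hf.2.ne hx

lemma memLp_top_posPart_sub {f : α → ℝ} (hf : MemLp f ⊤ μ) (c : ℝ) :
    MemLp (fun x => (f x - c)⁺) ⊤ μ :=
  (hf.sub (memLp_top_const c)).pos_part

lemma integrable_posPart_of_memLp_top {f : α → ℝ} (hf : MemLp f ⊤ μ)
    (hfin : μ {x | 0 ≤ f x} ≠ ⊤) : Integrable (fun x => (f x)⁺) μ := by
  have : IsFiniteMeasure (μ.restrict {x | 0 ≤ f x}) := ⟨by simpa using hfin.lt_top⟩
  have hsupp : Function.support (fun x => (f x)⁺) ⊆ {x | 0 ≤ f x} := fun x hx =>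
    not_lt.1 fun hlt => hx (posPart_eq_zero.2 hlt.le)
  exact (integrableOn_iff_integrable_of_support_subset hsupp).1
    ((hf.pos_part.restrict _).integrable le_top)

lemma memLp_two_of_integrable_of_memLp_top {f : α → ℝ} (hf : Integrable f μ)
    (hf' : MemLp f ⊤ μ) : MemLp f 2 μ := by
  rw [memLp_two_iff_integrable_sq hf.1]
  simp only [sq]
  exact hf.mul_of_top_left hf'

lemma sq_integral_mul_le {f g : α → ℝ} (hf : MemLp f 2 μ) (hg : MemLp g 2 μ) :
    (∫ x, f x * g x ∂μ) ^ 2 ≤ (∫ x, f x ^ 2 ∂μ) * ∫ x, g x ^ 2 ∂μ := by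
  have hquad : ∀ a : ℝ, 0 ≤ (∫ x, g x ^ 2 ∂μ) * (a * a) + (2 * ∫ x, f x * g x ∂μ) * a
      + ∫ x, f x ^ 2 ∂μ := by
    intro a
    calc 0 ≤ ∫ x, (f x + a * g x) ^ 2 ∂μ := integral_nonneg fun x => sq_nonneg _
      _ = ∫ x, (a * a * g x ^ 2 + 2 * a * (f x * g x)) + f x ^ 2 ∂μ := by
        congr with x; ring
      _ = _ := by
        have hg2 : Integrable (fun x => a * a * g x ^ 2) μ := hg.integrable_sq.const_mul _
        have hfg : Integrable (fun x => 2 * a * (f x * g x)) μ :=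
          (hf.integrable_mul hg).const_mul _
        rw [integral_add (by exact hg2.add hfg) hf.integrable_sq, integral_add hg2 hfg,
          integral_const_mul, integral_const_mul]
        ring
  have := discrim_le_zero hquad
  rw [discrim] at this
  linarith

lemma sq_integral_le_measureReal_mul {f : α → ℝ} {s : Set α} (hμs : μ s ≠ ⊤)
    (hf : MemLp f 2 μ) :
    (∫ x in s, f x ∂μ) ^ 2 ≤ μ.real s * ∫ x in s, f x ^ 2 ∂μ := by
  have : IsFiniteMeasure (μ.restrict s) := ⟨by simpa using hμs.lt_top⟩
  simpa using sq_integral_mul_le (memLp_const (1 : ℝ)) (hf.restrict s)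

lemma integral_sq_indicator {f : α → ℝ} {s : Set α} (hs : MeasurableSet s) :
    ∫ x, s.indicator f x ^ 2 ∂μ = ∫ x in s, f x ^ 2 ∂μ := by
  rw [← integral_indicator hs]
  congr with x
  by_cases hx : x ∈ s <;> simp [hx]

lemma exists_setIntegral_le_div {f : α → ℝ} (hf : Integrable f μ) (hf0 : ∀ x, 0 ≤ f x)
    {s : ℕ → Set α} (hs : ∀ j, MeasurableSet (s j)) (hdisj : Pairwise (Function.onFun Disjoint s))
    {N : ℕ} (hN : 0 < N) : ∃ j < N, ∫ x in s j, f x ∂μ ≤ (∫ x, f x ∂μ) / N := by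
  have hsum : ∑ j ∈ Finset.range N, ∫ x in s j, f x ∂μ ≤
      ∑ _j ∈ Finset.range N, (∫ x, f x ∂μ) / N := by
    rw [← integral_biUnion_finset _ (fun j _ => hs j) (hdisj.set_pairwise _)
      fun j _ => hf.integrableOn]
    simpa [mul_div_cancel₀, hN.ne'] using setIntegral_le_integral hf (ae_of_all _ hf0)
  obtain ⟨j, hj, hle⟩ := Finset.exists_le_of_sum_le (by simpa using hN.ne') hsum
  exact ⟨j, Finset.mem_range.1 hj, hle⟩

lemma integrable_of_tendsto_of_integral_le {u : α → ℝ} {p : ℕ → α → ℝ} {C : ℝ}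
    (hp : ∀ m, Integrable (p m) μ) (hp0 : ∀ m x, 0 ≤ p m x) (hC : ∀ m, ∫ x, p m x ∂μ ≤ C)
    (hlim : ∀ x, Tendsto (fun m => p m x) atTop (𝓝 (u x))) : Integrable u μ := by
  rw [← memLp_one_iff_integrable]
  refine ⟨aestronglyMeasurable_of_tendsto_ae _ (fun m => (hp m).1) (ae_of_all _ hlim), ?_⟩
  refine (Lp.eLpNorm_lim_le_liminf_eLpNorm (fun m => (hp m).1) u (ae_of_all _ hlim)).trans_lt ?_
  refine (liminf_le_of_frequently_le' (Frequently.of_forall fun m => ?_)).trans_lt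
    (ENNReal.ofReal_lt_top (r := C))
  rw [eLpNorm_one_eq_lintegral_enorm, ← ofReal_integral_norm_eq_lintegral_enorm (hp m)]
  simpa only [Real.norm_of_nonneg (hp0 m _)] using ENNReal.ofReal_le_ofReal (hC m)

lemma aemeasurable_uncurry_of_continuous_of_aemeasurable {ι β : Type*} [TopologicalSpace ι]
    [TopologicalSpace.MetrizableSpace ι] [SecondCountableTopology ι] [MeasurableSpace ι]
    [OpensMeasurableSpace ι] [TopologicalSpace β] [TopologicalSpace.PseudoMetrizableSpace β]
    [MeasurableSpace β] [BorelSpace β] [Nonempty β] [SFinite μ] {ν : Measure ι}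
    {u : ι → α → β} (hcont : ∀ x, Continuous fun i => u i x) (hmeas : ∀ i, AEMeasurable (u i) μ) :
    AEMeasurable (Function.uncurry u) (ν.prod μ) := by
  classical
  let c : β := Classical.arbitrary β
  obtain ⟨Q, hQc, hQd⟩ := TopologicalSpace.exists_countable_dense ι
  have hgood : ∀ᵐ x ∂μ, ∀ q ∈ Q, u q x = (hmeas q).mk _ x :=
    (ae_ball_iff hQc).2 fun q _ => (hmeas q).ae_eq_mk
  obtain ⟨S, hSsub, hSm, hS0⟩ := exists_measurable_superset_of_null (ae_iff.1 hgood)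
  -- On the null set `S` the function is modified to a constant.
  let v : ι → α → β := fun i => S.piecewise (fun _ => c) (u i)
  have hvcont : ∀ x, Continuous fun i => v i x := by
    intro x
    by_cases hx : x ∈ S
    · simpa [v, hx] using continuous_const
    · simpa [v, hx] using hcont x
  have hvQ : ∀ q ∈ Q, Measurable (v q) := by
    intro q hq
    have : v q = S.piecewise (fun _ => c) ((hmeas q).mk _) := by
      ext x
      by_cases hx : x ∈ S
      · simp [v, hx]
      · have hxgood : ∀ q ∈ Q, u q x = (hmeas q).mk _ x := not_not.1 fun h => hx (hSsub h)
        simp [v, hx, hxgood q hq]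
    rw [this]
    exact measurable_const.piecewise hSm (hmeas q).measurable_mk
  have hvmeas : ∀ i, Measurable (v i) := by
    intro i
    obtain ⟨q, hqQ, hq⟩ := mem_closure_iff_seq_limit.1 (hQd i)
    exact measurable_of_tendsto_metrizable (fun m => hvQ _ (hqQ m))
      (tendsto_pi_nhds.2 fun x => ((hvcont x).tendsto i).comp hq)
  refine ⟨Function.uncurry v, measurable_uncurry_of_continuous_of_measurable hvcont hvmeas, ?_⟩
  have hnull : ∀ᵐ p ∂ν.prod μ, p.2 ∉ S :=
    Measure.quasiMeasurePreserving_snd.ae (measure_eq_zero_iff_ae_notMem.1 hS0)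
  filter_upwards [hnull] with p hp
  simp [Function.uncurry, v, hp]

end MeasureTheory

/-- A probability density `k` with respect to `μ`. Integrability is forced by `integral_eq_one`,
since the Bochner integral of a non-integrable function is `0`. -/
structure IsDensity {V : Type*} [MeasurableSpace V] (k : V → ℝ) (μ : Measure V) : Prop where
  nonneg : ∀ x, 0 ≤ k x
  integral_eq_one : ∫ x, k x ∂μ = 1

lemma IsDensity.integrable {V : Type*} [MeasurableSpace V] {k : V → ℝ} {μ : Measure V}
    (hk : IsDensity k μ) : Integrable k μ :=
  .of_integral_ne_zero (by simp [hk.integral_eq_one])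

section Convolution

variable {V : Type*} [AddCommGroup V] [MeasurableSpace V] {μ : Measure V} {k f g u w : V → ℝ}

lemma convolution_nonneg (hk : ∀ x, 0 ≤ k x) (hf : ∀ x, 0 ≤ f x) (x : V) :
    0 ≤ (k ⋆[mul ℝ ℝ, μ] f) x :=
  integral_nonneg fun _ => mul_nonneg (hk _) (hf _)

lemma IsDensity.convolution_const (hk : IsDensity k μ) (C : ℝ) (x : V) :
    (k ⋆[mul ℝ ℝ, μ] fun _ => C) x = C := by
  rw [convolution_mul, integral_mul_const, hk.integral_eq_one, one_mul]

variable [MeasurableAdd₂ V] [MeasurableNeg V] [μ.IsAddLeftInvariant]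

lemma IsDensity.integral_convolution [SFinite μ] (hk : IsDensity k μ) (hf : Integrable f μ) :
    ∫ x, (k ⋆[mul ℝ ℝ, μ] f) x ∂μ = ∫ x, f x ∂μ := by
  rw [MeasureTheory.integral_convolution (mul ℝ ℝ) hk.integrable hf, hk.integral_eq_one,
    ContinuousLinearMap.mul_apply', one_mul]

lemma IsDensity.ae_eq_zero_of_lt_convolution [SFinite μ] (hk : IsDensity k μ)
    (hu : Integrable u μ) (hu0 : ∀ x, 0 ≤ u x)
    (hlt : ∀ᵐ x ∂μ, 0 < u x → u x < (k ⋆[mul ℝ ℝ, μ] u) x) : u =ᵐ[μ] 0 := by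
  have hconv : Integrable (k ⋆[mul ℝ ℝ, μ] u) μ := hk.integrable.integrable_convolution _ hu
  have hnonneg : 0 ≤ᵐ[μ] (k ⋆[mul ℝ ℝ, μ] u) - u := by
    filter_upwards [hlt] with x hx
    rcases (hu0 x).eq_or_lt with h0 | hpos
    · simpa [← h0] using convolution_nonneg hk.nonneg hu0 x
    · exact sub_nonneg.2 (hx hpos).le
  have hzero : (k ⋆[mul ℝ ℝ, μ] u) - u =ᵐ[μ] 0 := by
    refine (integral_eq_zero_iff_of_nonneg_ae hnonneg (hconv.sub hu)).1 ?_
    rw [integral_sub' hconv hu, hk.integral_convolution hu, sub_self]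
  filter_upwards [hlt, hzero] with x hx hx0
  by_contra hne
  have := hx ((hu0 x).lt_of_ne' hne)
  rw [Pi.sub_apply, Pi.zero_apply] at hx0
  linarith

variable [μ.IsNegInvariant]

lemma memLp_comp_sub_left {p : ENNReal} (hf : MemLp f p μ) (x : V) :
    MemLp (fun y => f (x - y)) p μ :=
  hf.comp_measurePreserving (Measure.measurePreserving_sub_left μ x)

lemma convolutionExistsAt_of_memLp_top (hk : Integrable k μ) (hf : MemLp f ⊤ μ) (x : V) :
    ConvolutionExistsAt k f x (mul ℝ ℝ) μ :=
  hk.mul_of_top_left (memLp_comp_sub_left hf x)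

lemma convolutionExistsAt_of_memLp_two (hf : MemLp f 2 μ) (hg : MemLp g 2 μ) (x : V) :
    ConvolutionExistsAt f g x (mul ℝ ℝ) μ :=
  hf.integrable_mul (memLp_comp_sub_left hg x)

lemma convolution_le_convolution_of_ae_le {x : V} (hk : ∀ x, 0 ≤ k x)
    (hf : ConvolutionExistsAt k f x (mul ℝ ℝ) μ) (hg : ConvolutionExistsAt k g x (mul ℝ ℝ) μ)
    (hfg : f ≤ᵐ[μ] g) : (k ⋆[mul ℝ ℝ, μ] f) x ≤ (k ⋆[mul ℝ ℝ, μ] g) x := by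
  refine integral_mono_ae hf hg ?_
  filter_upwards [(Measure.measurePreserving_sub_left μ x).quasiMeasurePreserving.ae hfg] with y hy
  exact mul_le_mul_of_nonneg_left hy (hk y)

lemma IsDensity.convolution_le_of_ae_le (hk : IsDensity k μ) {C : ℝ} (hf : MemLp f ⊤ μ)
    (hC : ∀ᵐ x ∂μ, f x ≤ C) (x : V) : (k ⋆[mul ℝ ℝ, μ] f) x ≤ C := by
  rw [← hk.convolution_const (μ := μ) C x]
  exact convolution_le_convolution_of_ae_le hk.nonneg
    (convolutionExistsAt_of_memLp_top hk.integrable hf x)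
    (convolutionExistsAt_of_memLp_top hk.integrable (memLp_top_const C) x) hC

lemma sq_convolution_le (hf : MemLp f 2 μ) (hg : MemLp g 2 μ) (x : V) :
    (f ⋆[mul ℝ ℝ, μ] g) x ^ 2 ≤ (∫ y, f y ^ 2 ∂μ) * ∫ y, g y ^ 2 ∂μ := by
  rw [convolution_mul, ← integral_sub_left_eq_self (fun y => g y ^ 2) μ x]
  exact sq_integral_mul_le hf (memLp_comp_sub_left hg x)

lemma sq_convolution_indicator_left_le (hk : MemLp k 2 μ) (hw : MemLp w 2 μ) {s : Set V}
    (hs : MeasurableSet s) (x : V) :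
    (s.indicator k ⋆[mul ℝ ℝ, μ] w) x ^ 2 ≤ (∫ y in s, k y ^ 2 ∂μ) * ∫ y, w y ^ 2 ∂μ := by
  rw [← integral_sq_indicator hs]
  exact sq_convolution_le (hk.indicator hs) hw x

lemma sq_convolution_indicator_right_le (hk : MemLp k 2 μ) (hw : MemLp w 2 μ) {s : Set V}
    (hs : MeasurableSet s) (x : V) :
    (k ⋆[mul ℝ ℝ, μ] s.indicator w) x ^ 2 ≤ (∫ y, k y ^ 2 ∂μ) * ∫ y in s, w y ^ 2 ∂μ := by
  rw [← integral_sq_indicator hs]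
  exact sq_convolution_le hk (hw.indicator hs) x

lemma IsDensity.convolution_le_posPart_sub_add (hk : IsDensity k μ) (hf : MemLp f ⊤ μ)
    (c : ℝ) (x : V) : (k ⋆[mul ℝ ℝ, μ] f) x ≤ (k ⋆[mul ℝ ℝ, μ] fun y => (f y - c)⁺) x + c := by
  have hexists {h : V → ℝ} (hh : MemLp h ⊤ μ) : ConvolutionExistsAt k h x (mul ℝ ℝ) μ :=
    convolutionExistsAt_of_memLp_top hk.integrable hh x
  have hpos := memLp_top_posPart_sub hf c
  have hconst : MemLp (fun _ : V => c) ⊤ μ := memLp_top_const c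
  calc (k ⋆[mul ℝ ℝ, μ] f) x
      ≤ (k ⋆[mul ℝ ℝ, μ] ((fun y => (f y - c)⁺) + fun _ => c)) x :=
        convolution_le_convolution_of_ae_le hk.nonneg (hexists hf) (hexists (hpos.add hconst))
          (ae_of_all _ fun y => sub_le_iff_le_add.1 (le_posPart _))
    _ = _ := by rw [(hexists hpos).distrib_add (hexists hconst), hk.convolution_const]

variable [SFinite μ]

lemma IsDensity.integrable_posPart_sub_of_le (hk : IsDensity k μ) {θ C : ℝ} (hθ0 : 0 ≤ θ)
    (hθ1 : θ < 1) (hg : Integrable g μ) (hg0 : ∀ x, 0 ≤ g x) (hu : MemLp u ⊤ μ)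
    (hC : ∀ᵐ x ∂μ, u x ≤ C) (hle : ∀ᵐ x ∂μ, u x ≤ g x + θ * (k ⋆[mul ℝ ℝ, μ] u) x) (m : ℕ) :
    Integrable (fun x => (u x - C * θ ^ m)⁺) μ ∧
      ∫ x, (u x - C * θ ^ m)⁺ ∂μ ≤ (∫ x, g x ∂μ) / (1 - θ) := by
  induction m with
  | zero =>
    have hzero : (fun x => (u x - C * θ ^ 0)⁺) =ᵐ[μ] 0 := by
      filter_upwards [hC] with x hx
      simpa using hx
    rw [integrable_congr hzero, integral_congr_ae hzero]
    exact ⟨integrable_zero _ _ _, by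
      simpa using div_nonneg (integral_nonneg hg0) (sub_nonneg.2 hθ1.le)⟩
  | succ m ih =>
    obtain ⟨hp, hpint⟩ := ih
    set p : V → ℝ := fun x => (u x - C * θ ^ m)⁺
    have hpconv : Integrable (k ⋆[mul ℝ ℝ, μ] p) μ := hk.integrable.integrable_convolution _ hp
    have hstep : ∀ᵐ x ∂μ, (u x - C * θ ^ (m + 1))⁺ ≤ g x + θ * (k ⋆[mul ℝ ℝ, μ] p) x := by
      filter_upwards [hle] with x hx
      refine max_le ?_ (add_nonneg (hg0 x) (mul_nonneg hθ0
        (convolution_nonneg hk.nonneg (fun _ => posPart_nonneg _) x)))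
      calc u x - C * θ ^ (m + 1)
          ≤ g x + θ * ((k ⋆[mul ℝ ℝ, μ] p) x + C * θ ^ m) - C * θ ^ (m + 1) := by
            gcongr
            exact hx.trans (by gcongr; exact hk.convolution_le_posPart_sub_add hu _ x)
        _ = _ := by ring
    have hmajor : Integrable (fun x => g x + θ * (k ⋆[mul ℝ ℝ, μ] p) x) μ :=
      hg.add (hpconv.const_mul θ)
    have hint : Integrable (fun x => (u x - C * θ ^ (m + 1))⁺) μ := by
      refine hmajor.mono' (memLp_top_posPart_sub hu _).1 ?_
      filter_upwards [hstep] with x hx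
      rwa [Real.norm_of_nonneg (posPart_nonneg _)]
    refine ⟨hint, ?_⟩
    calc _ ≤ ∫ x, g x + θ * (k ⋆[mul ℝ ℝ, μ] p) x ∂μ := integral_mono_ae hint hmajor hstep
      _ = ∫ x, g x ∂μ + θ * ∫ x, p x ∂μ := by
        rw [integral_add hg (hpconv.const_mul θ), integral_const_mul, hk.integral_convolution hp]
      _ ≤ ∫ x, g x ∂μ + θ * ((∫ x, g x ∂μ) / (1 - θ)) := by gcongr
      _ = (∫ x, g x ∂μ) / (1 - θ) := by
        have : 1 - θ ≠ 0 := (sub_pos.2 hθ1).ne'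
        field_simp
        ring

lemma IsDensity.integrable_of_le_add_mul_convolution (hk : IsDensity k μ) {θ : ℝ} (hθ0 : 0 ≤ θ)
    (hθ1 : θ < 1) (hg : Integrable g μ) (hg0 : ∀ x, 0 ≤ g x) (hu : MemLp u ⊤ μ)
    (hu0 : ∀ x, 0 ≤ u x) (hle : ∀ᵐ x ∂μ, u x ≤ g x + θ * (k ⋆[mul ℝ ℝ, μ] u) x) :
    Integrable u μ := by
  obtain ⟨C, -, hC⟩ := ae_abs_le_of_memLp_top hu
  have hp := hk.integrable_posPart_sub_of_le hθ0 hθ1 hg hg0 hu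
    (hC.mono fun x hx => (le_abs_self _).trans hx) hle
  refine integrable_of_tendsto_of_integral_le (fun m => (hp m).1) (fun _ _ => posPart_nonneg _)
    (fun m => (hp m).2) fun x => ?_
  have hlim : Tendsto (fun m : ℕ => u x - C * θ ^ m) atTop (𝓝 (u x)) := by
    simpa using tendsto_const_nhds.sub
      ((tendsto_pow_atTop_nhds_zero_of_lt_one hθ0 hθ1).const_mul C)
  have := (continuous_posPart.tendsto _).comp hlim
  rwa [posPart_eq_self.2 (hu0 x)] at this

section TimeIntegral

variable {a b : ℝ} {u : ℝ → V → ℝ}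

lemma integrable_prod_mul_of_memLp_top (hk : Integrable k μ)
    (hu : MemLp (Function.uncurry u) ⊤ ((volume.restrict (uIoc a b)).prod μ)) (x : V) :
    Integrable (fun p : ℝ × V => k (x - p.2) * u p.1 p.2)
      ((volume.restrict (uIoc a b)).prod μ) := by
  have : IsFiniteMeasure (volume.restrict (uIoc a b)) := ⟨by simp [uIoc]⟩
  exact ((hk.comp_sub_left x).comp_snd _).mul_of_top_left hu

lemma intervalIntegrable_convolution (hk : Integrable k μ)
    (hu : MemLp (Function.uncurry u) ⊤ ((volume.restrict (uIoc a b)).prod μ)) (x : V) :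
    IntervalIntegrable (fun s => (k ⋆[mul ℝ ℝ, μ] u s) x) volume a b := by
  rw [intervalIntegrable_iff]
  simp only [convolution_mul_swap]
  exact (integrable_prod_mul_of_memLp_top hk hu x).integral_prod_left

lemma intervalIntegral_convolution (hk : Integrable k μ)
    (hu : MemLp (Function.uncurry u) ⊤ ((volume.restrict (uIoc a b)).prod μ)) (x : V) :
    ∫ s in a..b, (k ⋆[mul ℝ ℝ, μ] u s) x = (k ⋆[mul ℝ ℝ, μ] fun y => ∫ s in a..b, u s y) x := by
  simp only [convolution_mul_swap, ← intervalIntegral.integral_const_mul]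
  exact intervalIntegral_integral_swap (integrable_prod_mul_of_memLp_top hk hu x)

end TimeIntegral

end Convolution

/-- The heat `d ∫₀ᵗ γ⁺(s, x) ds` released at `x` up to time `t`. -/
noncomputable def accumulatedHeat {α : Type*} (d : ℝ) (γ : ℝ → α → ℝ) (t : ℝ) (x : α) : ℝ :=
  d * ∫ s in 0..t, (γ s x)⁺

lemma accumulatedHeat_nonneg {α : Type*} {d : ℝ} (hd : 0 ≤ d) (γ : ℝ → α → ℝ) {t : ℝ}
    (ht : 0 ≤ t) (x : α) : 0 ≤ accumulatedHeat d γ t x :=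
  mul_nonneg hd (intervalIntegral.integral_nonneg ht fun _ _ => posPart_nonneg _)

namespace IsSolution

variable {n : ℕ} {d : ℝ} {k γ₀ : E n → ℝ} {γ : ℝ → E n → ℝ}

lemma memLp_top_of_nonneg (h : IsSolution d k γ₀ γ) (h0 : MemLp γ₀ ⊤ volume) {t : ℝ}
    (ht : 0 ≤ t) : MemLp (γ t) ⊤ volume := by
  rcases ht.eq_or_lt with rfl | hpos
  · rwa [funext h.initial]
  · exact h.memLp_top t hpos

lemma hasDerivAt (h : IsSolution d k γ₀ γ) {t : ℝ} (ht : 0 < t) (x : E n) :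
    HasDerivAt (fun s => γ s x)
      (d * (k ⋆[mul ℝ ℝ, volume] fun y => (γ t y)⁺) x - d * (γ t x)⁺) t := by
  have hpos (y : E n) : indicator {y | 0 < γ t y} (γ t) y = (γ t y)⁺ := by
    by_cases hy : 0 < γ t y
    · simp [hy, posPart_eq_self.2 hy.le]
    · simp [hy, posPart_eq_zero.2 (not_lt.1 hy)]
  convert h.equation t ht x using 3
  · have hS : NullMeasurableSet {y | 0 < γ t y} :=
      nullMeasurableSet_lt aemeasurable_const (h.memLp_top t ht).1.aemeasurable
    rw [convolution_mul_swap, ← integral_indicator₀ hS]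
    refine integral_congr_ae (ae_of_all _ fun y => ?_)
    simp only [← hpos, indicator_mul_right]
  · exact (hpos x).symm

lemma continuousOn (h : IsSolution d k γ₀ γ) (x : E n) :
    ContinuousOn (fun s => γ s x) (Ici 0) := by
  intro s hs
  rcases (mem_Ici.1 hs).eq_or_lt with rfl | hpos
  · exact h.continuous_zero x
  · exact (h.hasDerivAt hpos x).continuousAt.continuousWithinAt

lemma continuousOn_Icc (h : IsSolution d k γ₀ γ) (x : E n) {s t : ℝ} (hs : 0 ≤ s) :
    ContinuousOn (fun r => γ r x) (Icc s t) :=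
  (h.continuousOn x).mono fun _ hr => hs.trans hr.1

lemma continuousOn_posPart (h : IsSolution d k γ₀ γ) (x : E n) {t : ℝ} :
    ContinuousOn (fun s => (γ s x)⁺) (Icc 0 t) :=
  continuous_posPart.comp_continuousOn (h.continuousOn_Icc x le_rfl)

lemma le_of_le_of_nonpos (h : IsSolution d k γ₀ γ) (hd : 0 ≤ d) (hk : ∀ x, 0 ≤ k x) {s t c : ℝ}
    (hs : 0 ≤ s) (hst : s ≤ t) (hc : c ≤ 0) {x : E n} (hx : c ≤ γ s x) : c ≤ γ t x := by
  refine le_of_hasDerivAt_nonneg_of_lt hst (h.continuousOn_Icc x hs)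
    (fun r hr => h.hasDerivAt (hs.trans_lt hr.1) x) (fun r _ hrc => ?_) hx
  rw [posPart_eq_zero.2 (hrc.le.trans hc), mul_zero, sub_zero]
  exact mul_nonneg hd (convolution_nonneg hk (fun _ => posPart_nonneg _) x)

lemma region_mono (h : IsSolution d k γ₀ γ) (hd : 0 ≤ d) (hk : ∀ x, 0 ≤ k x) {s t : ℝ}
    (hs : 0 ≤ s) (hst : s ≤ t) : region γ s ⊆ region γ t :=
  fun _ hx => h.le_of_le_of_nonpos hd hk hs hst le_rfl hx

lemma posPart_le_exp_mul (h : IsSolution d k γ₀ γ) (hd : 0 ≤ d) (hk : ∀ x, 0 ≤ k x) {s t : ℝ}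
    (hs : 0 ≤ s) (hst : s ≤ t) (x : E n) :
    (γ s x)⁺ ≤ Real.exp (d * (t - s)) * (γ t x)⁺ := by
  refine max_le ?_ (mul_nonneg (Real.exp_pos _).le (posPart_nonneg _))
  rcases le_total (γ s x) 0 with hneg | hpos
  · exact hneg.trans (mul_nonneg (Real.exp_pos _).le (posPart_nonneg _))
  have hstay : ∀ r, s ≤ r → (γ r x)⁺ = γ r x := fun r hr =>
    posPart_eq_self.2 (h.le_of_le_of_nonpos hd hk hs hr le_rfl hpos)
  have hexp (r : ℝ) : HasDerivAt (fun r => Real.exp (d * (r - s)))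
      (Real.exp (d * (r - s)) * d) r := by
    simpa using (((hasDerivAt_id r).sub_const s).const_mul d).exp
  -- `r ↦ e^{d (r - s)} γ(r, x)` has derivative `d e^{d (r - s)} (k ⋆ γ⁺(r))(x) ≥ 0`.
  have hmono : γ s x ≤ Real.exp (d * (t - s)) * γ t x := by
    have := sub_le_sub_of_hasDerivAt_le (f := fun _ => 0) (f' := fun _ => 0) hst
      continuousOn_const ((Continuous.continuousOn (by fun_prop)).mul (h.continuousOn_Icc x hs))
      (fun r _ => hasDerivAt_const r 0)
      (fun r hr => (hexp r).mul (h.hasDerivAt (hs.trans_lt hr.1) x)) fun r hr => ?_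
    · simpa using this
    · have hconv : 0 ≤ (k ⋆[mul ℝ ℝ, volume] fun y => (γ r y)⁺) x :=
        convolution_nonneg hk (fun _ => posPart_nonneg _) x
      rw [hstay r hr.1.le]
      calc 0 ≤ Real.exp (d * (r - s)) * (d * (k ⋆[mul ℝ ℝ, volume] fun y => (γ r y)⁺) x) := by
            positivity
        _ = _ := by ring
  rwa [hstay t hst]

lemma exists_posPart_le (h : IsSolution d k γ₀ γ) (hd : 0 ≤ d) (hk : ∀ x, 0 ≤ k x)
    (h0 : MemLp γ₀ ⊤ volume) {T : ℝ} (hT : 0 ≤ T) :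
    ∃ C, ∀ᵐ x, ∀ t ∈ Icc 0 T, (γ t x)⁺ ≤ C := by
  obtain ⟨C, hC0, hC⟩ := ae_abs_le_of_memLp_top (h.memLp_top_of_nonneg h0 hT)
  refine ⟨Real.exp (d * T) * C, hC.mono fun x hx t ht => ?_⟩
  calc (γ t x)⁺ ≤ Real.exp (d * (T - t)) * (γ T x)⁺ := h.posPart_le_exp_mul hd hk ht.1 ht.2 x
    _ ≤ Real.exp (d * T) * C := by
      have hpos : (γ T x)⁺ ≤ C := max_le ((le_abs_self _).trans hx) hC0
      gcongr
      linarith [ht.1]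

lemma memLp_top_uncurry_posPart (h : IsSolution d k γ₀ γ) (hd : 0 ≤ d) (hk : ∀ x, 0 ≤ k x)
    (h0 : MemLp γ₀ ⊤ volume) {t : ℝ} (ht : 0 ≤ t) :
    MemLp (Function.uncurry fun s x => (γ s x)⁺) ⊤
      ((volume.restrict (uIoc 0 t)).prod volume) := by
  have htime : ∀ᵐ p ∂(volume.restrict (uIoc 0 t)).prod (volume : Measure (E n)), p.1 ∈ Ioc 0 t :=
    Measure.quasiMeasurePreserving_fst.ae
      (by simpa only [uIoc_of_le ht] using ae_restrict_mem measurableSet_Ioc)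
  have hmeas : AEMeasurable (Function.uncurry fun s x => (γ (max s 0) x)⁺)
      ((volume.restrict (uIoc 0 t)).prod volume) := by
    refine aemeasurable_uncurry_of_continuous_of_aemeasurable (fun x => ?_) fun s => ?_
    · exact continuous_posPart.comp ((h.continuousOn x).comp_continuous (by fun_prop)
        fun s => le_max_right s 0)
    · exact (h.memLp_top_of_nonneg h0 (le_max_right s 0)).pos_part.1.aemeasurable
  obtain ⟨C, hC⟩ := h.exists_posPart_le hd hk h0 ht
  refine memLp_top_of_bound (AEMeasurable.aestronglyMeasurable (hmeas.congr ?_)) C ?_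
  · filter_upwards [htime] with p hp
    simp [Function.uncurry, max_eq_left hp.1.le]
  · filter_upwards [htime, Measure.quasiMeasurePreserving_snd.ae hC] with p hp hpC
    rw [Function.uncurry, Real.norm_of_nonneg (posPart_nonneg _)]
    exact hpC p.1 ⟨hp.1.le, hp.2⟩

lemma accumulatedHeat_le_of_posPart_le (h : IsSolution d k γ₀ γ) (hd : 0 ≤ d) {t T C : ℝ}
    (ht : 0 ≤ t) (htT : t ≤ T) {x : E n} (hC : ∀ s ∈ Icc 0 T, (γ s x)⁺ ≤ C) :
    accumulatedHeat d γ t x ≤ d * t * C := by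
  have : ∫ s in 0..t, (γ s x)⁺ ≤ ∫ _s in 0..t, C :=
    intervalIntegral.integral_mono_on ht ((h.continuousOn_posPart x).intervalIntegrable_of_Icc ht)
      intervalIntegrable_const fun s hs => hC s ⟨hs.1, hs.2.trans htT⟩
  rw [intervalIntegral.integral_const, sub_zero, smul_eq_mul] at this
  rw [accumulatedHeat, mul_assoc]
  gcongr

lemma memLp_top_accumulatedHeat (h : IsSolution d k γ₀ γ) (hd : 0 ≤ d) (hk : ∀ x, 0 ≤ k x)
    (h0 : MemLp γ₀ ⊤ volume) {t : ℝ} (ht : 0 ≤ t) :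
    MemLp (accumulatedHeat d γ t) ⊤ volume := by
  obtain ⟨C, hC⟩ := h.exists_posPart_le hd hk h0 ht
  refine memLp_top_of_bound ?_ (d * t * C) ?_
  · have := (h.memLp_top_uncurry_posPart hd hk h0 ht).1.prod_swap.integral_prod_right'
    refine (this.const_mul d).congr (ae_of_all _ fun x => ?_)
    simp only [accumulatedHeat, intervalIntegral.integral_of_le ht, uIoc_of_le ht]
    rfl
  · filter_upwards [hC] with x hx
    rw [Real.norm_of_nonneg (accumulatedHeat_nonneg hd γ ht x)]
    exact h.accumulatedHeat_le_of_posPart_le hd ht le_rfl hx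

lemma sub_eq_convolution_accumulatedHeat_sub (h : IsSolution d k γ₀ γ) (hd : 0 ≤ d)
    (hk : IsDensity k volume) (h0 : MemLp γ₀ ⊤ volume) {t : ℝ} (ht : 0 ≤ t) (x : E n) :
    γ t x - γ₀ x =
      (k ⋆[mul ℝ ℝ, volume] accumulatedHeat d γ t) x - accumulatedHeat d γ t x := by
  have hprod := h.memLp_top_uncurry_posPart hd hk.nonneg h0 ht
  have hconv := intervalIntegrable_convolution hk.integrable hprod x
  have hpos : IntervalIntegrable (fun s => (γ s x)⁺) volume 0 t :=
    (h.continuousOn_posPart x).intervalIntegrable_of_Icc ht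
  have hheat : (k ⋆[mul ℝ ℝ, volume] accumulatedHeat d γ t) x =
      d * ∫ s in 0..t, (k ⋆[mul ℝ ℝ, volume] fun y => (γ s y)⁺) x := by
    rw [show accumulatedHeat d γ t = d • fun y => ∫ s in 0..t, (γ s y)⁺ from rfl,
      convolution_smul, Pi.smul_apply, smul_eq_mul,
      ← intervalIntegral_convolution hk.integrable hprod]
  rw [hheat, accumulatedHeat, ← intervalIntegral.integral_const_mul,
    ← intervalIntegral.integral_const_mul,
    ← intervalIntegral.integral_sub (hconv.const_mul d) (hpos.const_mul d), ← h.initial x]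
  exact (intervalIntegral.integral_eq_sub_of_hasDerivAt_of_le ht (h.continuousOn_Icc x le_rfl)
    (fun s hs => h.hasDerivAt hs.1 x) ((hconv.const_mul d).sub (hpos.const_mul d))).symm

lemma accumulatedHeat_le_mul_posPart (h : IsSolution d k γ₀ γ) (hd : 0 < d) (hk : ∀ x, 0 ≤ k x)
    {t : ℝ} (ht : 0 ≤ t) (x : E n) :
    accumulatedHeat d γ t x ≤ (Real.exp (d * t) - 1) * (γ t x)⁺ := by
  have hint : ∫ s in 0..t, Real.exp (d * (t - s)) * (γ t x)⁺ =
      (Real.exp (d * t) - 1) / d * (γ t x)⁺ := by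
    rw [intervalIntegral.integral_mul_const,
      intervalIntegral.integral_comp_sub_left (fun r => Real.exp (d * r)), sub_self, sub_zero,
      intervalIntegral.integral_comp_mul_left _ hd.ne', integral_exp, mul_zero, Real.exp_zero,
      smul_eq_mul, inv_mul_eq_div]
  rw [accumulatedHeat, ← le_div_iff₀' hd, mul_div_right_comm, ← hint]
  exact intervalIntegral.integral_mono_on ht
    ((h.continuousOn_posPart x).intervalIntegrable_of_Icc ht)
    (Continuous.intervalIntegrable (by fun_prop) _ _)
    fun s hs => h.posPart_le_exp_mul hd.le hk hs.1 hs.2 x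

lemma pos_of_accumulatedHeat_pos (h : IsSolution d k γ₀ γ) (hd : 0 < d) (hk : ∀ x, 0 ≤ k x)
    {t : ℝ} (ht : 0 ≤ t) {x : E n} (hx : 0 < accumulatedHeat d γ t x) : 0 < γ t x := by
  by_contra! hneg
  have := h.accumulatedHeat_le_mul_posPart hd hk ht x
  rw [posPart_eq_zero.2 hneg, mul_zero] at this
  exact this.not_gt hx

lemma accumulatedHeat_le_mul (h : IsSolution d k γ₀ γ) (hd : 0 < d) (hk : IsDensity k volume)
    (h0 : MemLp γ₀ ⊤ volume) {t : ℝ} (ht : 0 ≤ t) (x : E n) :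
    accumulatedHeat d γ t x ≤ (1 - Real.exp (-(d * t))) * (γ₀ x)⁺
      + (1 - Real.exp (-(d * t))) * (k ⋆[mul ℝ ℝ, volume] accumulatedHeat d γ t) x := by
  set w := accumulatedHeat d γ t x
  set c := (k ⋆[mul ℝ ℝ, volume] accumulatedHeat d γ t) x
  have hθ : 0 ≤ 1 - Real.exp (-(d * t)) :=
    sub_nonneg.2 (Real.exp_le_one_iff.2 (neg_nonpos.2 (by positivity)))
  rcases le_or_gt w 0 with hw0 | hwpos
  · have hc0 : 0 ≤ c := convolution_nonneg hk.nonneg (accumulatedHeat_nonneg hd.le γ ht) x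
    exact hw0.trans (add_nonneg (mul_nonneg hθ (posPart_nonneg _)) (mul_nonneg hθ hc0))
  have hpos : 0 < γ t x := h.pos_of_accumulatedHeat_pos hd hk.nonneg ht hwpos
  have hle : w ≤ (Real.exp (d * t) - 1) * γ t x := by
    simpa only [posPart_eq_self.2 hpos.le] using h.accumulatedHeat_le_mul_posPart hd hk.nonneg ht x
  have hexp : Real.exp (-(d * t)) * Real.exp (d * t) = 1 := by rw [← Real.exp_add]; simp
  calc w = Real.exp (-(d * t)) * w + (1 - Real.exp (-(d * t))) * w := by ring
    _ ≤ Real.exp (-(d * t)) * ((Real.exp (d * t) - 1) * γ t x)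
        + (1 - Real.exp (-(d * t))) * w := by gcongr
    _ = (1 - Real.exp (-(d * t))) * (γ t x + w) := by linear_combination γ t x * hexp
    _ ≤ (1 - Real.exp (-(d * t))) * ((γ₀ x)⁺ + c) := by
      refine mul_le_mul_of_nonneg_left ?_ hθ
      linarith [h.sub_eq_convolution_accumulatedHeat_sub hd.le hk h0 ht x, le_posPart (γ₀ x)]
    _ = _ := by ring

lemma integrable_accumulatedHeat (h : IsSolution d k γ₀ γ) (hd : 0 < d) (hk : IsDensity k volume)
    (h0 : MemLp γ₀ ⊤ volume) (hpos : Integrable fun x => (γ₀ x)⁺) {t : ℝ} (ht : 0 ≤ t) :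
    Integrable (accumulatedHeat d γ t) := by
  have hθ0 : 0 ≤ 1 - Real.exp (-(d * t)) :=
    sub_nonneg.2 (Real.exp_le_one_iff.2 (neg_nonpos.2 (by positivity)))
  exact hk.integrable_of_le_add_mul_convolution hθ0 (sub_lt_self 1 (Real.exp_pos _))
    (hpos.const_mul _) (fun x => mul_nonneg hθ0 (posPart_nonneg _))
    (h.memLp_top_accumulatedHeat hd.le hk.nonneg h0 ht)
    (accumulatedHeat_nonneg hd.le γ ht) (ae_of_all _ (h.accumulatedHeat_le_mul hd hk h0 ht))

lemma exists_region_eq (h : IsSolution d k γ₀ γ) (hd : 0 < d) (hk : IsDensity k volume)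
    (h0 : MemLp γ₀ ⊤ volume) {ℓ : ℝ} (hℓ : 0 < ℓ) (hneg : ∀ x, γ₀ x < 0 → γ₀ x ≤ -ℓ) :
    ∃ t₀ > 0, ∀ t, 0 ≤ t → t ≤ t₀ → region γ t = region γ 0 := by
  obtain ⟨C, hC⟩ := h.exists_posPart_le hd.le hk.nonneg h0 zero_le_one
  refine ⟨min 1 (ℓ / (d * |C| + 1)), by positivity, fun t ht htt₀ => ?_⟩
  refine subset_antisymm (fun x hx => ?_) (h.region_mono hd.le hk.nonneg le_rfl ht)
  by_contra hx0
  have hγ₀ : γ₀ x ≤ -ℓ := hneg x (by simpa [region, h.initial] using hx0)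
  have hconv : (k ⋆[mul ℝ ℝ, volume] accumulatedHeat d γ t) x ≤ d * t * C :=
    hk.convolution_le_of_ae_le (h.memLp_top_accumulatedHeat hd.le hk.nonneg h0 ht)
      (hC.mono fun y hy => h.accumulatedHeat_le_of_posPart_le hd.le ht
        (htt₀.trans (min_le_left _ _)) hy) x
  have hsmall : d * t * C < ℓ :=
    calc d * t * C ≤ t * (d * |C|) := by
          rw [mul_comm d, mul_assoc]
          gcongr
          exact le_abs_self C
      _ ≤ ℓ / (d * |C| + 1) * (d * |C|) := by
          gcongr
          exact htt₀.trans (min_le_right _ _)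
      _ < ℓ := by
          rw [div_mul_eq_mul_div, div_lt_iff₀ (by positivity)]
          exact mul_lt_mul_of_pos_left (lt_add_one _) hℓ
  have hγ := h.sub_eq_convolution_accumulatedHeat_sub hd.le hk h0 ht x
  have hheat := accumulatedHeat_nonneg hd.le γ ht x
  have hx : 0 ≤ γ t x := hx
  linarith

end IsSolution

section HeatProfile

/-- A nonnegative function `w` that, like every accumulated heat, satisfies
`γ = γ₀ + k ⋆ w - w` with `γ ≥ 0` on the initial region `D` and on `{w > 0}`, where the initial
datum satisfies `γ₀ ≤ G` on `D` and `γ₀ ≤ -ℓ` off `D`. Time and the diffusion rate no longer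
appear. -/
structure IsHeatProfile {V : Type*} [AddCommGroup V] [MeasurableSpace V] (k : V → ℝ)
    (μ : Measure V) (D : Set V) (ℓ G : ℝ) (w : V → ℝ) : Prop where
  integrable : Integrable w μ
  memLp_top : MemLp w ⊤ μ
  nonneg : ∀ x, 0 ≤ w x
  neg_le_of_mem : ∀ᵐ x ∂μ, x ∈ D → -G ≤ (k ⋆[mul ℝ ℝ, μ] w) x - w x
  le_of_notMem : ∀ x ∉ D, 0 < w x → ℓ ≤ (k ⋆[mul ℝ ℝ, μ] w) x - w x

namespace IsHeatProfile

variable {V : Type*} [AddCommGroup V] [MeasurableSpace V] {μ : Measure V} {k w : V → ℝ}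
  {D : Set V} {ℓ G : ℝ}

lemma memLp_two (hw : IsHeatProfile k μ D ℓ G w) : MemLp w 2 μ :=
  memLp_two_of_integrable_of_memLp_top hw.integrable hw.memLp_top

lemma le_convolution_of_notMem (hw : IsHeatProfile k μ D ℓ G w) (hk : ∀ x, 0 ≤ k x)
    (hℓ : 0 ≤ ℓ) {x : V} (hx : x ∉ D) : w x ≤ (k ⋆[mul ℝ ℝ, μ] w) x := by
  rcases (hw.nonneg x).eq_or_lt with h0 | hpos
  · exact h0 ▸ convolution_nonneg hk hw.nonneg x
  · exact sub_nonneg.1 (hℓ.trans (hw.le_of_notMem x hx hpos))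

variable [MeasurableAdd₂ V] [MeasurableNeg V] [μ.IsAddLeftInvariant] [SFinite μ]

-- Integrate `(k ⋆ w - w) + G 1_D ≥ 0`, which is at least `ℓ` on `{w > 0} \ D`; the first term has
-- integral zero.
lemma measure_pos_le (hw : IsHeatProfile k μ D ℓ G w) (hk : IsDensity k μ)
    (hD : NullMeasurableSet D μ) (hDμ : μ D ≠ ⊤) (hℓ : 0 < ℓ) :
    μ {x | 0 < w x} ≤ μ D + ENNReal.ofReal (μ.real D * G / ℓ) := by
  set f : V → ℝ := (k ⋆[mul ℝ ℝ, μ] w) - w + D.indicator fun _ => G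
  have hconv : Integrable (k ⋆[mul ℝ ℝ, μ] w) μ :=
    hk.integrable.integrable_convolution _ hw.integrable
  have hind : Integrable (D.indicator fun _ => G) μ :=
    (integrableOn_const hDμ).integrable_indicator₀ hD
  have hf : Integrable f μ := (hconv.sub hw.integrable).add hind
  have hf0 : 0 ≤ᵐ[μ] f := by
    filter_upwards [hw.neg_le_of_mem] with x hx
    by_cases hxD : x ∈ D
    · simpa [f, hxD, neg_le_iff_add_nonneg] using hx hxD
    · simpa [f, hxD] using hw.le_convolution_of_notMem hk.nonneg hℓ.le hxD
  have hfint : ∫ x, f x ∂μ = μ.real D * G := by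
    rw [integral_add' (hconv.sub hw.integrable) hind, integral_sub' hconv hw.integrable,
      hk.integral_convolution hw.integrable, sub_self, zero_add, integral_indicator₀ hD,
      setIntegral_const, smul_eq_mul]
  have hmarkov : μ {x | ℓ ≤ f x} ≤ ENNReal.ofReal (μ.real D * G / ℓ) := by
    have := mul_meas_ge_le_integral_of_nonneg hf0 hf ℓ
    rw [hfint] at this
    rw [← ofReal_measureReal (hf.measure_ge_lt_top hℓ).ne]
    exact ENNReal.ofReal_le_ofReal ((le_div_iff₀' hℓ).2 this)
  calc μ {x | 0 < w x} ≤ μ (D ∪ {x | ℓ ≤ f x}) := by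
        refine measure_mono fun x hx => or_iff_not_imp_left.2 fun hxD => ?_
        simpa [f, hxD] using hw.le_of_notMem x hxD hx
    _ ≤ μ D + μ {x | ℓ ≤ f x} := measure_union_le _ _
    _ ≤ _ := by gcongr

lemma sq_integral_le (hw : IsHeatProfile k μ D ℓ G w) (hk : IsDensity k μ)
    (hD : NullMeasurableSet D μ) (hDμ : μ D ≠ ⊤) (hℓ : 0 < ℓ) (hG : 0 ≤ G) :
    (∫ x, w x ∂μ) ^ 2 ≤ (μ.real D + μ.real D * G / ℓ) * ∫ x, w x ^ 2 ∂μ := by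
  have hle := hw.measure_pos_le hk hD hDμ hℓ
  have hfin : μ {x | 0 < w x} ≠ ⊤ := ne_top_of_le_ne_top (by finiteness) hle
  have hreal : μ.real {x | 0 < w x} ≤ μ.real D + μ.real D * G / ℓ := by
    have := ENNReal.toReal_mono (by finiteness) hle
    rwa [ENNReal.toReal_add hDμ (by finiteness), ENNReal.toReal_ofReal (by positivity)] at this
  have hsupp : ∀ x ∉ {x | 0 < w x}, w x = 0 := fun x hx => (not_lt.1 hx).antisymm (hw.nonneg x)
  calc (∫ x, w x ∂μ) ^ 2 = (∫ x in {x | 0 < w x}, w x ∂μ) ^ 2 := by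
        rw [setIntegral_eq_integral_of_forall_compl_eq_zero hsupp]
    _ ≤ μ.real {x | 0 < w x} * ∫ x in {x | 0 < w x}, w x ^ 2 ∂μ :=
        sq_integral_le_measureReal_mul hfin hw.memLp_two
    _ ≤ _ := by
        rw [setIntegral_eq_integral_of_forall_compl_eq_zero fun x hx => by simp [hsupp x hx]]
        gcongr

lemma integral_sq_sub_le (hw : IsHeatProfile k μ D ℓ G w) (hk : IsDensity k μ)
    (hD : NullMeasurableSet D μ) (hℓ : 0 ≤ ℓ) :
    ∫ x, w x ^ 2 ∂μ - ∫ x, w x * (k ⋆[mul ℝ ℝ, μ] w) x ∂μ ≤ G * ∫ x in D, w x ∂μ := by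
  have hconv : Integrable (fun x => w x * (k ⋆[mul ℝ ℝ, μ] w) x) μ :=
    (hk.integrable.integrable_convolution _ hw.integrable).mul_of_top_right hw.memLp_top
  rw [← integral_sub hw.memLp_two.integrable_sq hconv, ← integral_const_mul,
    ← integral_indicator₀ hD]
  refine integral_mono_ae (hw.memLp_two.integrable_sq.sub hconv)
    ((hw.integrable.const_mul G).integrableOn.integrable_indicator₀ hD) ?_
  filter_upwards [hw.neg_le_of_mem] with x hx
  have hfactor : w x ^ 2 - w x * (k ⋆[mul ℝ ℝ, μ] w) x =
      w x * (w x - (k ⋆[mul ℝ ℝ, μ] w) x) := by ring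
  rw [hfactor]
  by_cases hxD : x ∈ D
  · rw [indicator_of_mem hxD, mul_comm G]
    exact mul_le_mul_of_nonneg_left (by linarith [hx hxD]) (hw.nonneg x)
  · rw [indicator_of_notMem hxD]
    exact mul_nonpos_of_nonneg_of_nonpos (hw.nonneg x)
      (sub_nonpos.2 (hw.le_convolution_of_notMem hk.nonneg hℓ hxD))

lemma integral_sq_le_of_gap (hw : IsHeatProfile k μ D ℓ G w) (hk : IsDensity k μ)
    (hD : NullMeasurableSet D μ) (hDμ : μ D ≠ ⊤) (hℓ : 0 ≤ ℓ) {c : ℝ} (hc : 0 < c)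
    (hgap : c * ∫ x, w x ^ 2 ∂μ ≤ ∫ x, w x ^ 2 ∂μ - ∫ x, w x * (k ⋆[mul ℝ ℝ, μ] w) x ∂μ) :
    ∫ x, w x ^ 2 ∂μ ≤ G ^ 2 * μ.real D / c ^ 2 := by
  set a := ∫ x, w x ^ 2 ∂μ
  have ha : 0 ≤ a := integral_nonneg fun _ => sq_nonneg _
  have hgapD : c * a ≤ G * ∫ x in D, w x ∂μ := hgap.trans (hw.integral_sq_sub_le hk hD hℓ)
  have hcauchy : (∫ x in D, w x ∂μ) ^ 2 ≤ μ.real D * a :=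
    (sq_integral_le_measureReal_mul hDμ hw.memLp_two).trans (by
      gcongr
      exact setIntegral_le_integral hw.memLp_two.integrable_sq (ae_of_all _ fun _ => sq_nonneg _))
  rw [le_div_iff₀ (by positivity)]
  rcases ha.eq_or_lt with h0 | hpos
  · rw [← h0, zero_mul]
    positivity
  refine le_of_mul_le_mul_right ?_ hpos
  calc a * c ^ 2 * a = (c * a) ^ 2 := by ring
    _ ≤ (G * ∫ x in D, w x ∂μ) ^ 2 := by gcongr
    _ = G ^ 2 * (∫ x in D, w x ∂μ) ^ 2 := mul_pow _ _ _
    _ ≤ G ^ 2 * (μ.real D * a) := by gcongr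
    _ = G ^ 2 * μ.real D * a := by ring

end IsHeatProfile

end HeatProfile

section SpectralGap

/-- The autocorrelation `h ↦ ∫ w(x) w(x - h) dx` of a real function `w`. -/
noncomputable def autocorrelation {V : Type*} [AddCommGroup V] [MeasurableSpace V] (w : V → ℝ)
    (μ : Measure V) (h : V) : ℝ :=
  ∫ x, w x * w (x - h) ∂μ

section Autocorrelation

variable {V : Type*} [AddCommGroup V] [MeasurableSpace V] {μ : Measure V} {k w : V → ℝ}

lemma autocorrelation_eq_convolution :
    autocorrelation w μ = w ⋆[mul ℝ ℝ, μ] fun x => w (-x) := by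
  ext h
  simp only [autocorrelation, convolution_mul, neg_sub]

lemma autocorrelation_nonneg (hw0 : ∀ x, 0 ≤ w x) (h : V) : 0 ≤ autocorrelation w μ h :=
  integral_nonneg fun _ => mul_nonneg (hw0 _) (hw0 _)

lemma autocorrelation_zero : autocorrelation w μ 0 = ∫ x, w x ^ 2 ∂μ := by
  simp only [autocorrelation, sub_zero, sq]

variable [MeasurableAdd₂ V] [μ.IsAddLeftInvariant]

lemma integral_comp_sub_mul_comp_sub (g h : V) :
    ∫ x, w (x - g) * w (x - h) ∂μ = autocorrelation w μ (h - g) := by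
  rw [autocorrelation, ← integral_sub_right_eq_self (fun x => w x * w (x - (h - g))) g]
  simp only [sub_sub, add_sub_cancel]

lemma memLp_comp_sub_right {p : ENNReal} (hw : MemLp w p μ) (h : V) :
    MemLp (fun x => w (x - h)) p μ :=
  hw.comp_measurePreserving (measurePreserving_sub_right μ h)

lemma integral_sq_comp_sub_sub_comp_sub (hw : MemLp w 2 μ) (g h : V) :
    ∫ x, (w (x - g) - w (x - h)) ^ 2 ∂μ =
      2 * (autocorrelation w μ 0 - autocorrelation w μ (h - g)) := by
  have hint (a b : V) : Integrable (fun x => w (x - a) * w (x - b)) μ :=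
    (memLp_comp_sub_right hw a).integrable_mul (memLp_comp_sub_right hw b)
  have hexpand (x : V) : (w (x - g) - w (x - h)) ^ 2 =
      w (x - g) * w (x - g) + w (x - h) * w (x - h) - 2 * (w (x - g) * w (x - h)) := by ring
  simp only [hexpand]
  rw [integral_sub (by exact (hint g g).add (hint h h)) ((hint g h).const_mul 2),
    integral_add (hint g g) (hint h h), integral_const_mul]
  simp only [integral_comp_sub_mul_comp_sub, sub_self]
  ring

lemma autocorrelation_le_autocorrelation_zero (hw : MemLp w 2 μ) (h : V) :
    autocorrelation w μ h ≤ autocorrelation w μ 0 := by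
  have hsq : 0 ≤ ∫ x, (w (x - 0) - w (x - h)) ^ 2 ∂μ := integral_nonneg fun _ => sq_nonneg _
  rw [integral_sq_comp_sub_sub_comp_sub hw, sub_zero] at hsq
  linarith

lemma autocorrelation_zero_sub_add_self_le (hw : MemLp w 2 μ) (h : V) :
    autocorrelation w μ 0 - autocorrelation w μ (h + h) ≤
      4 * (autocorrelation w μ 0 - autocorrelation w μ h) := by
  have hint (a b : V) : Integrable (fun x => (w (x - a) - w (x - b)) ^ 2) μ :=
    ((memLp_comp_sub_right hw a).sub (memLp_comp_sub_right hw b)).integrable_sq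
  have hle : ∫ x, (w (x - 0) - w (x - (h + h))) ^ 2 ∂μ ≤
      ∫ x, 2 * (w (x - 0) - w (x - h)) ^ 2 + 2 * (w (x - h) - w (x - (h + h))) ^ 2 ∂μ := by
    refine integral_mono (hint _ _) (((hint _ _).const_mul 2).add ((hint _ _).const_mul 2))
      fun x => ?_
    linarith [add_sq_le (a := w (x - 0) - w (x - h)) (b := w (x - h) - w (x - (h + h))),
      sub_add_sub_cancel (w (x - 0)) (w (x - h)) (w (x - (h + h)))]
  rw [integral_add ((hint _ _).const_mul 2) ((hint _ _).const_mul 2), integral_const_mul,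
    integral_const_mul] at hle
  simp only [integral_sq_comp_sub_sub_comp_sub hw] at hle
  simp only [sub_zero, add_sub_cancel_right] at hle
  linarith

variable [MeasurableNeg V] [SFinite μ]

lemma integrable_prod_mul_mul_comp_sub (hk : Integrable k μ) (hw : Integrable w μ)
    (hw' : MemLp w ⊤ μ) :
    Integrable (fun p : V × V => w p.1 * (k p.2 * w (p.1 - p.2))) (μ.prod μ) := by
  obtain ⟨C, -, hC⟩ := ae_abs_le_of_memLp_top hw'
  exact (hk.convolution_integrand (mul ℝ ℝ) hw).bdd_mul hw'.1.comp_fst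
    (Measure.quasiMeasurePreserving_fst.ae hC)

lemma integrable_mul_autocorrelation (hk : Integrable k μ) (hw : Integrable w μ)
    (hw' : MemLp w ⊤ μ) : Integrable (fun h => k h * autocorrelation w μ h) μ := by
  simpa only [autocorrelation, ← integral_const_mul, mul_left_comm]
    using (integrable_prod_mul_mul_comp_sub hk hw hw').integral_prod_right

lemma integral_mul_convolution (hk : Integrable k μ) (hw : Integrable w μ) (hw' : MemLp w ⊤ μ) :
    ∫ x, w x * (k ⋆[mul ℝ ℝ, μ] w) x ∂μ = ∫ h, k h * autocorrelation w μ h ∂μ := by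
  simp only [convolution_mul, ← integral_const_mul, autocorrelation]
  rw [integral_integral_swap (integrable_prod_mul_mul_comp_sub hk hw hw')]
  simp only [mul_left_comm]

lemma IsDensity.integral_sq_sub_integral_mul_convolution (hk : IsDensity k μ)
    (hw : Integrable w μ) (hw' : MemLp w ⊤ μ) :
    ∫ x, w x ^ 2 ∂μ - ∫ x, w x * (k ⋆[mul ℝ ℝ, μ] w) x ∂μ =
      ∫ h, k h * (autocorrelation w μ 0 - autocorrelation w μ h) ∂μ := by
  simp only [mul_sub]
  rw [integral_sub (hk.integrable.mul_const _)
      (integrable_mul_autocorrelation hk.integrable hw hw'),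
    integral_mul_const, hk.integral_eq_one, one_mul, autocorrelation_zero,
    integral_mul_convolution hk.integrable hw hw']

lemma IsDensity.mul_setIntegral_le (hk : IsDensity k μ) {s : Set V} (hs : MeasurableSet s)
    {c : ℝ} (hck : ∀ h ∈ s, c ≤ k h) (hw : Integrable w μ) (hw' : MemLp w ⊤ μ)
    (hint : IntegrableOn (fun h => autocorrelation w μ 0 - autocorrelation w μ h) s μ) :
    c * ∫ h in s, (autocorrelation w μ 0 - autocorrelation w μ h) ∂μ ≤
      ∫ x, w x ^ 2 ∂μ - ∫ x, w x * (k ⋆[mul ℝ ℝ, μ] w) x ∂μ := by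
  have hA0 (h : V) : 0 ≤ autocorrelation w μ 0 - autocorrelation w μ h :=
    sub_nonneg.2 (autocorrelation_le_autocorrelation_zero
      (memLp_two_of_integrable_of_memLp_top hw hw') h)
  have hkA : Integrable (fun h => k h * (autocorrelation w μ 0 - autocorrelation w μ h)) μ := by
    simp only [mul_sub]
    exact (hk.integrable.mul_const _).sub (integrable_mul_autocorrelation hk.integrable hw hw')
  rw [hk.integral_sq_sub_integral_mul_convolution hw hw', ← integral_const_mul]
  calc _ ≤ ∫ h in s, k h * (autocorrelation w μ 0 - autocorrelation w μ h) ∂μ :=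
        setIntegral_mono_on (hint.const_mul c) hkA.integrableOn hs
          fun h hh => mul_le_mul_of_nonneg_right (hck h hh) (hA0 h)
    _ ≤ _ := setIntegral_le_integral hkA (ae_of_all _ fun h => mul_nonneg (hk.nonneg h) (hA0 h))

variable [μ.IsNegInvariant]

lemma integrable_autocorrelation (hw : Integrable w μ) : Integrable (autocorrelation w μ) μ := by
  rw [autocorrelation_eq_convolution]
  exact hw.integrable_convolution _ hw.comp_neg

lemma integral_autocorrelation (hw : Integrable w μ) :
    ∫ h, autocorrelation w μ h ∂μ = (∫ x, w x ∂μ) ^ 2 := by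
  rw [autocorrelation_eq_convolution, MeasureTheory.integral_convolution _ hw hw.comp_neg,
    integral_neg_eq_self w, ContinuousLinearMap.mul_apply', sq]

lemma measureReal_mul_sub_sq_integral_le {s : Set V} (hs : μ s ≠ ⊤) (hw : Integrable w μ)
    (hw0 : ∀ x, 0 ≤ w x) :
    μ.real s * autocorrelation w μ 0 - (∫ x, w x ∂μ) ^ 2 ≤
      ∫ h in s, (autocorrelation w μ 0 - autocorrelation w μ h) ∂μ := by
  have hA := integrable_autocorrelation hw
  have hconst : IntegrableOn (fun _ : V => autocorrelation w μ 0) s μ := integrableOn_const hs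
  rw [integral_sub hconst hA.integrableOn, setIntegral_const, smul_eq_mul,
    ← integral_autocorrelation hw]
  exact sub_le_sub_left
    (setIntegral_le_integral hA (ae_of_all _ (autocorrelation_nonneg hw0))) _

end Autocorrelation

variable {V : Type*} [NormedAddCommGroup V] [NormedSpace ℝ V] [FiniteDimensional ℝ V]
  [MeasurableSpace V] {μ : Measure V} {k f : V → ℝ} {C r : ℝ}

lemma integrableOn_ball_of_locallyIntegrable (hf : LocallyIntegrable f μ) (r : ℝ) :
    IntegrableOn f (Metric.ball 0 r) μ :=
  (hf.integrableOn_isCompact (isCompact_closedBall 0 r)).mono_set Metric.ball_subset_closedBall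

variable [BorelSpace V] [μ.IsAddHaarMeasure]

lemma setIntegral_ball_two_mul_le (hf : LocallyIntegrable f μ) (hf0 : ∀ x, 0 ≤ f x)
    (hC : ∀ x, f (x + x) ≤ C * f x) (r : ℝ) :
    ∫ x in Metric.ball 0 (2 * r), f x ∂μ ≤
      2 ^ Module.finrank ℝ V * C * ∫ x in Metric.ball 0 r, f x ∂μ := by
  have hscale := Measure.setIntegral_comp_smul_of_pos μ f (Metric.ball 0 r) two_pos
  rw [smul_ball two_ne_zero, smul_zero, Real.norm_two, smul_eq_mul,
    eq_inv_mul_iff_mul_eq₀ (by positivity)] at hscale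
  rw [← hscale, mul_assoc]
  gcongr
  rw [← integral_const_mul]
  refine integral_mono_of_nonneg (ae_of_all _ fun x => hf0 _)
    ((integrableOn_ball_of_locallyIntegrable hf r).const_mul C) (ae_of_all _ fun x => ?_)
  simpa only [two_smul] using hC x

lemma setIntegral_ball_two_pow_mul_le (hf : LocallyIntegrable f μ) (hf0 : ∀ x, 0 ≤ f x)
    (hC0 : 0 ≤ C) (hC : ∀ x, f (x + x) ≤ C * f x) (r : ℝ) (m : ℕ) :
    ∫ x in Metric.ball 0 (2 ^ m * r), f x ∂μ ≤
      (2 ^ Module.finrank ℝ V * C) ^ m * ∫ x in Metric.ball 0 r, f x ∂μ := by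
  induction m with
  | zero => simp
  | succ m ih =>
    rw [pow_succ', mul_assoc, pow_succ', mul_assoc (2 ^ Module.finrank ℝ V * C)]
    exact (setIntegral_ball_two_mul_le hf hf0 hC _).trans (by gcongr)

variable [Nontrivial V]

lemma exists_le_measureReal_ball_two_pow_mul (μ : Measure V) [μ.IsAddHaarMeasure] (hr : 0 < r)
    (M : ℝ) : ∃ m : ℕ, M ≤ μ.real (Metric.ball 0 (2 ^ m * r)) := by
  have hball : 0 < μ.real (Metric.ball 0 r) :=
    ENNReal.toReal_pos (Metric.measure_ball_pos _ _ hr).ne' measure_ball_lt_top.ne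
  obtain ⟨m, hm⟩ := pow_unbounded_of_one_lt (M / μ.real (Metric.ball 0 r)) one_lt_two
  refine ⟨m, ((div_lt_iff₀ hball).1 hm).le.trans ?_⟩
  rw [measureReal_def, measureReal_def, Measure.addHaar_ball_mul_of_pos μ _ (by positivity),
    ENNReal.toReal_mul, ENNReal.toReal_ofReal (by positivity)]
  gcongr
  exact le_self_pow₀ (one_le_pow₀ one_le_two) Module.finrank_pos.ne'

-- For `a(h) = ∫ w² - ∫ w(x) w(x - h) dx` one has `a(2h) ≤ 4 a(h)`, so the average of `a` over a
-- small ball, where `k` is bounded below, controls its average over a ball of measure `M + 1`, on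
-- which `∫ a ≥ (M + 1) ∫ w² - (∫ w)²`.
theorem IsDensity.exists_spectral_gap (hk : IsDensity k μ) {c : ℝ} (hc : 0 < c)
    (hck : ∀ᶠ h in 𝓝 0, c ≤ k h) (M : ℝ) :
    ∃ ε > 0, ∀ w : V → ℝ, Integrable w μ → MemLp w ⊤ μ → (∀ x, 0 ≤ w x) →
      (∫ x, w x ∂μ) ^ 2 ≤ M * ∫ x, w x ^ 2 ∂μ →
      ε * ∫ x, w x ^ 2 ∂μ ≤ ∫ x, w x ^ 2 ∂μ - ∫ x, w x * (k ⋆[mul ℝ ℝ, μ] w) x ∂μ := by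
  obtain ⟨r, hr, hball⟩ := Metric.eventually_nhds_iff_ball.1 hck
  obtain ⟨m, hm⟩ := exists_le_measureReal_ball_two_pow_mul μ hr (M + 1)
  set q : ℝ := (2 ^ Module.finrank ℝ V * 4) ^ m
  refine ⟨c / q, by positivity, fun w hw hw' hw0 hM => ?_⟩
  have hw2 : MemLp w 2 μ := memLp_two_of_integrable_of_memLp_top hw hw'
  have hA : LocallyIntegrable (fun h => autocorrelation w μ 0 - autocorrelation w μ h) μ :=
    (locallyIntegrable_const _).sub (integrable_autocorrelation hw).locallyIntegrable
  have hlarge : ∫ x, w x ^ 2 ∂μ ≤ ∫ h in Metric.ball 0 (2 ^ m * r),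
      (autocorrelation w μ 0 - autocorrelation w μ h) ∂μ := by
    refine le_trans ?_ (measureReal_mul_sub_sq_integral_le measure_ball_lt_top.ne hw hw0)
    rw [autocorrelation_zero]
    have hsq : 0 ≤ ∫ x, w x ^ 2 ∂μ := integral_nonneg fun x => sq_nonneg (w x)
    linarith [mul_le_mul_of_nonneg_right hm hsq]
  have hdoubling := setIntegral_ball_two_pow_mul_le hA
    (fun h => sub_nonneg.2 (autocorrelation_le_autocorrelation_zero hw2 h)) zero_le_four
    (autocorrelation_zero_sub_add_self_le hw2) r m
  refine le_trans ?_ (hk.mul_setIntegral_le measurableSet_ball hball hw hw'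
    (integrableOn_ball_of_locallyIntegrable hA r))
  rw [div_mul_eq_mul_div, mul_div_assoc]
  gcongr
  exact (div_le_iff₀' (by positivity)).2 (hlarge.trans hdoubling)

end SpectralGap

section Tail

variable {V : Type*} [NormedAddCommGroup V] [MeasurableSpace V] [OpensMeasurableSpace V]
  {μ : Measure V} {k f w : V → ℝ}

lemma exists_setIntegral_norm_ge_lt (hf : Integrable f μ) {ε : ℝ} (hε : 0 < ε) :
    ∃ L, 0 ≤ L ∧ ∫ x in norm ⁻¹' Ici L, f x ∂μ < ε := by
  have hlim := tendsto_setIntegral_of_antitone (f := f) (μ := μ)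
    (s := fun L : ℝ => norm ⁻¹' Ici L) (fun L => measurable_norm measurableSet_Ici)
    (fun _ _ hab => preimage_mono (Ici_subset_Ici.2 hab)) ⟨0, hf.integrableOn⟩
  rw [← preimage_iInter, iInter_eq_empty_iff.2 fun a => ⟨a + 1, by simp⟩,
    preimage_empty, setIntegral_empty] at hlim
  exact ((eventually_ge_atTop 0).and (hlim.eventually_lt_const hε)).exists

lemma exists_setIntegral_annulus_le_div (hf : Integrable f μ) (hf0 : ∀ x, 0 ≤ f x) (r : ℝ)
    {L : ℝ} (hL : 0 ≤ L) {m : ℕ} (hm : 0 < m) :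
    ∃ s, r ≤ s ∧ s + L ≤ r + m * L ∧
      ∫ x in norm ⁻¹' Ico s (s + L), f x ∂μ ≤ (∫ x, f x ∂μ) / m := by
  have hmono : Monotone fun j : ℕ => r + j * L := fun i j hij => by
    dsimp only
    gcongr
  obtain ⟨j, hjm, hj⟩ := exists_setIntegral_le_div hf hf0
    (s := fun j : ℕ => norm ⁻¹' Ico (r + j * L) (r + (j + 1 : ℕ) * L))
    (fun j => measurable_norm measurableSet_Ico)
    (fun i j hij => (hmono.pairwise_disjoint_on_Ico_succ hij).preimage _) hm
  have hstep : r + (j + 1 : ℕ) * L = r + j * L + L := by push_cast; ring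
  rw [hstep] at hj
  exact ⟨r + j * L, le_add_of_nonneg_right (by positivity), hstep ▸ hmono hjm, hj⟩

variable [MeasurableAdd₂ V] [MeasurableNeg V] [μ.IsAddLeftInvariant]

lemma IsHeatProfile.convolution_lt_of_le_norm [SFinite μ] {D : Set V} {ℓ G : ℝ}
    (hw : IsHeatProfile k μ D ℓ G w) (hk : IsDensity k μ) {s : ℝ} (hD : ∀ x ∈ D, ‖x‖ < s)
    (hlt : ∀ x, s ≤ ‖x‖ →
      (k ⋆[mul ℝ ℝ, μ] w) x < (k ⋆[mul ℝ ℝ, μ] (norm ⁻¹' Ici s).indicator w) x + ℓ)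
    {x : V} (hx : s ≤ ‖x‖) : (k ⋆[mul ℝ ℝ, μ] w) x < ℓ := by
  set u : V → ℝ := (norm ⁻¹' Ici s).indicator w
  have hsub : ∀ y, 0 < u y → u y < (k ⋆[mul ℝ ℝ, μ] u) y := by
    intro y hy
    have hys : s ≤ ‖y‖ := mem_of_indicator_ne_zero (s := norm ⁻¹' Ici s) hy.ne'
    have huy : u y = w y := indicator_of_mem (s := norm ⁻¹' Ici s) hys w
    rw [huy] at hy ⊢
    linarith [hlt y hys, hw.le_of_notMem y (fun hyD => (hD y hyD).not_ge hys) hy]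
  have hu : u =ᵐ[μ] 0 := hk.ae_eq_zero_of_lt_convolution
    (hw.integrable.indicator (measurable_norm measurableSet_Ici))
    (fun y => indicator_nonneg (fun _ _ => hw.nonneg _) y) (ae_of_all _ hsub)
  have hlt := hlt x hx
  rwa [convolution_congr _ .rfl hu, convolution_zero, Pi.zero_apply, zero_add] at hlt

variable [μ.IsNegInvariant]

lemma convolution_le_add_add_of_add_le_norm (hk : MemLp k 2 μ) (hk0 : ∀ x, 0 ≤ k x)
    (hw : MemLp w 2 μ) (hw0 : ∀ x, 0 ≤ w x) {s L : ℝ} {x : V} (hx : s + L ≤ ‖x‖) :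
    (k ⋆[mul ℝ ℝ, μ] w) x ≤ ((norm ⁻¹' Ici L).indicator k ⋆[mul ℝ ℝ, μ] w) x
      + (k ⋆[mul ℝ ℝ, μ] (norm ⁻¹' Ico s (s + L)).indicator w) x
      + (k ⋆[mul ℝ ℝ, μ] (norm ⁻¹' Ici (s + L)).indicator w) x := by
  have hind {f : V → ℝ} (hf : MemLp f 2 μ) {t : Set ℝ} (ht : MeasurableSet t) :
      MemLp ((norm ⁻¹' t).indicator f) 2 μ := hf.indicator (measurable_norm ht)
  have hfar := convolutionExistsAt_of_memLp_two (hind hk (measurableSet_Ici (a := L))) hw x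
  have hann := convolutionExistsAt_of_memLp_two hk
    (hind hw (measurableSet_Ico (a := s) (b := s + L))) x
  have hout := convolutionExistsAt_of_memLp_two hk
    (hind hw (measurableSet_Ici (a := s + L))) x
  have hcover : ∀ y, ‖y‖ < L → w (x - y) = (norm ⁻¹' Ico s (s + L)).indicator w (x - y)
      + (norm ⁻¹' Ici (s + L)).indicator w (x - y) := by
    intro y hy
    have hs : s ≤ ‖x - y‖ := by linarith [norm_sub_norm_le x y]
    rcases lt_or_ge ‖x - y‖ (s + L) with hlt | hge
    · simp [hs, hlt, hlt.not_ge]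
    · simp [hge, hge.not_gt]
  simp only [convolution]
  rw [← integral_add hfar hann, ← integral_add (by exact hfar.add hann) hout]
  refine integral_mono (convolutionExistsAt_of_memLp_two hk hw x) ((hfar.add hann).add hout)
    fun y => ?_
  have hnonneg (t : Set ℝ) : 0 ≤ k y * (norm ⁻¹' t).indicator w (x - y) :=
    mul_nonneg (hk0 y) (indicator_nonneg (fun _ _ => hw0 _) _)
  simp only [ContinuousLinearMap.mul_apply']
  rcases lt_or_ge ‖y‖ L with hlt | hge
  · nth_rw 1 [hcover y hlt]
    rw [mul_add, add_assoc]
    exact le_add_of_nonneg_left (mul_nonneg (indicator_nonneg (fun _ _ => hk0 _) _) (hw0 _))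
  · rw [indicator_of_mem (by simpa using hge), add_assoc]
    exact le_add_of_nonneg_right (add_nonneg (hnonneg _) (hnonneg _))

lemma exists_convolution_lt_convolution_indicator_add (hk : MemLp k 2 μ) (hk0 : ∀ x, 0 ≤ k x)
    {B : ℝ} (hB : 0 ≤ B) (r : ℝ) {ε : ℝ} (hε : 0 < ε) :
    ∃ R, ∀ w : V → ℝ, MemLp w 2 μ → (∀ x, 0 ≤ w x) → ∫ x, w x ^ 2 ∂μ ≤ B →
      ∃ s ∈ Icc r R, ∀ x, s ≤ ‖x‖ →
        (k ⋆[mul ℝ ℝ, μ] w) x < (k ⋆[mul ℝ ℝ, μ] (norm ⁻¹' Ici s).indicator w) x + ε := by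
  obtain ⟨L, hL0, hL⟩ := exists_setIntegral_norm_ge_lt (μ := μ) hk.integrable_sq
    (show 0 < (ε / 2) ^ 2 / (B + 1) by positivity)
  obtain ⟨m, hm⟩ := exists_nat_gt ((∫ x, k x ^ 2 ∂μ) * B / (ε / 2) ^ 2)
  have hm0 : 0 < (m : ℝ) := lt_of_le_of_lt (by positivity) hm
  refine ⟨r + m * L, fun w hw hw0 hwB => ?_⟩
  obtain ⟨s, hrs, hsL, hs⟩ := exists_setIntegral_annulus_le_div hw.integrable_sq
    (fun _ => sq_nonneg _) r hL0 (Nat.cast_pos.1 hm0)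
  refine ⟨s + L, ⟨hrs.trans (le_add_of_nonneg_right hL0), hsL⟩, fun x hx => ?_⟩
  have hfar : ((norm ⁻¹' Ici L).indicator k ⋆[mul ℝ ℝ, μ] w) x < ε / 2 := by
    refine lt_of_pow_lt_pow_left₀ 2 (by positivity)
      ((sq_convolution_indicator_left_le hk hw (measurable_norm measurableSet_Ici) x).trans_lt ?_)
    calc _ ≤ (∫ y in norm ⁻¹' Ici L, k y ^ 2 ∂μ) * (B + 1) := by
          gcongr
          linarith
      _ < _ := (lt_div_iff₀ (by positivity)).1 hL
  have hannulus : (k ⋆[mul ℝ ℝ, μ] (norm ⁻¹' Ico s (s + L)).indicator w) x < ε / 2 := by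
    refine lt_of_pow_lt_pow_left₀ 2 (by positivity)
      ((sq_convolution_indicator_right_le hk hw (measurable_norm measurableSet_Ico) x).trans_lt ?_)
    calc _ ≤ (∫ y, k y ^ 2 ∂μ) * (B / m) := by
          gcongr
          exact hs.trans (by gcongr)
      _ = (∫ y, k y ^ 2 ∂μ) * B / m := by ring
      _ < _ := (div_lt_comm₀ (by positivity) hm0).1 hm
  linarith [convolution_le_add_add_of_add_le_norm hk hk0 hw hw0 hx]

end Tail

/-- A square integrable probability density bounded below near the origin by a positive constant:
what the a priori bound on the heat requires of the kernel. -/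
structure IsSpreadingKernel {V : Type*} [NormedAddCommGroup V] [MeasurableSpace V] (k : V → ℝ)
    (μ : Measure V) : Prop extends IsDensity k μ where
  memLp_two : MemLp k 2 μ
  exists_pos_le : ∃ c > 0, ∀ᶠ x in 𝓝 0, c ≤ k x

lemma IsKernel.isSpreadingKernel {n : ℕ} {k : E n → ℝ} (hk : IsKernel k) :
    IsSpreadingKernel k volume where
  nonneg := hk.nonneg
  integral_eq_one := hk.integral_eq_one
  memLp_two := memLp_two_of_integrable_of_memLp_top
    (IsDensity.mk hk.nonneg hk.integral_eq_one).integrable hk.memLp_top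
  exists_pos_le := ⟨k 0 / 2, half_pos hk.pos_zero,
    hk.continuous.continuousAt.eventually_const_le (half_lt_self hk.pos_zero)⟩

theorem IsSpreadingKernel.exists_convolution_lt {V : Type*} [NormedAddCommGroup V]
    [NormedSpace ℝ V] [FiniteDimensional ℝ V] [Nontrivial V] [MeasurableSpace V] [BorelSpace V]
    {μ : Measure V} [μ.IsAddHaarMeasure] {k : V → ℝ} (hk : IsSpreadingKernel k μ) {D : Set V}
    (hD : NullMeasurableSet D μ) (hbdd : Bornology.IsBounded D) {ℓ G : ℝ} (hℓ : 0 < ℓ)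
    (hG : 0 ≤ G) :
    ∃ R, ∀ w, IsHeatProfile k μ D ℓ G w → ∀ x, R ≤ ‖x‖ → (k ⋆[mul ℝ ℝ, μ] w) x < ℓ := by
  have hDμ : μ D ≠ ⊤ := hbdd.measure_lt_top.ne
  obtain ⟨r, hr⟩ := hbdd.exists_norm_le
  obtain ⟨c, hc, hck⟩ := hk.exists_pos_le
  obtain ⟨ε, hε, hgap⟩ := hk.exists_spectral_gap hc hck (μ.real D + μ.real D * G / ℓ)
  obtain ⟨R, hR⟩ := exists_convolution_lt_convolution_indicator_add hk.memLp_two hk.nonneg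
    (show 0 ≤ G ^ 2 * μ.real D / ε ^ 2 by positivity) (r + 1) hℓ
  refine ⟨R, fun w hw x hx => ?_⟩
  have hL2 : ∫ x, w x ^ 2 ∂μ ≤ G ^ 2 * μ.real D / ε ^ 2 :=
    hw.integral_sq_le_of_gap hk.toIsDensity hD hDμ hℓ.le hε
      (hgap w hw.integrable hw.memLp_top hw.nonneg
        (hw.sq_integral_le hk.toIsDensity hD hDμ hℓ hG))
  obtain ⟨s, ⟨hrs, hsR⟩, hs⟩ := hR w hw.memLp_two hw.nonneg hL2
  exact hw.convolution_lt_of_le_norm hk.toIsDensity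
    (fun y hy => by linarith [hr y hy]) hs (hsR.trans hx)

namespace IsSolution

variable {n : ℕ} {d ℓ G t : ℝ} {k γ₀ : E n → ℝ} {γ : ℝ → E n → ℝ}

lemma isHeatProfile_accumulatedHeat (h : IsSolution d k γ₀ γ) (hd : 0 < d)
    (hk : IsDensity k volume) (h0 : MemLp γ₀ ⊤ volume) (hpos : Integrable fun x => (γ₀ x)⁺)
    (hG : ∀ᵐ x, γ₀ x ≤ G) (hneg : ∀ x, γ₀ x < 0 → γ₀ x ≤ -ℓ) (ht : 0 ≤ t) :
    IsHeatProfile k volume {x | 0 ≤ γ₀ x} ℓ G (accumulatedHeat d γ t) where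
  integrable := h.integrable_accumulatedHeat hd hk h0 hpos ht
  memLp_top := h.memLp_top_accumulatedHeat hd.le hk.nonneg h0 ht
  nonneg := accumulatedHeat_nonneg hd.le γ ht
  neg_le_of_mem := by
    filter_upwards [hG] with x hx hxD
    have hγ : 0 ≤ γ t x :=
      h.le_of_le_of_nonpos hd.le hk.nonneg le_rfl ht le_rfl (by rwa [h.initial])
    linarith [h.sub_eq_convolution_accumulatedHeat_sub hd.le hk h0 ht x]
  le_of_notMem x hxD hx := by
    have hγ : 0 < γ t x := h.pos_of_accumulatedHeat_pos hd hk.nonneg ht hx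
    linarith [h.sub_eq_convolution_accumulatedHeat_sub hd.le hk h0 ht x, hneg x (not_le.1 hxD)]

lemma le_convolution_of_mem_region (h : IsSolution d k γ₀ γ) (hd : 0 ≤ d)
    (hk : IsDensity k volume) (h0 : MemLp γ₀ ⊤ volume) (hneg : ∀ x, γ₀ x < 0 → γ₀ x ≤ -ℓ)
    (ht : 0 ≤ t) {x : E n} (hx : x ∈ region γ t) (hx0 : γ₀ x < 0) :
    ℓ ≤ (k ⋆[mul ℝ ℝ, volume] accumulatedHeat d γ t) x := by
  have hγ : 0 ≤ γ t x := hx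
  linarith [h.sub_eq_convolution_accumulatedHeat_sub hd hk h0 ht x, hneg x hx0,
    accumulatedHeat_nonneg hd γ ht x]

end IsSolution

lemma exists_region_subset_ball {n : ℕ} {k : E n → ℝ} (hk : IsSpreadingKernel k volume)
    {γ₀ : E n → ℝ} (h0 : MemLp γ₀ ⊤ volume) {ℓ : ℝ} (hℓ : 0 < ℓ)
    (hneg : ∀ x, γ₀ x < 0 → γ₀ x ≤ -ℓ) (hbdd : Bornology.IsBounded {x | 0 ≤ γ₀ x}) :
    ∃ R > 0, ∀ d > 0, ∀ γ, IsSolution d k γ₀ γ → ∀ t, 0 ≤ t →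
      region γ t ⊆ Metric.ball 0 R := by
  rcases subsingleton_or_nontrivial (E n) with _ | _
  · exact ⟨1, one_pos, fun d _ γ _ t _ x _ => by simp [Subsingleton.elim x 0]⟩
  obtain ⟨G, hG0, hG⟩ := ae_abs_le_of_memLp_top h0
  have hpos := integrable_posPart_of_memLp_top h0 hbdd.measure_lt_top.ne
  have hD : NullMeasurableSet {x | 0 ≤ γ₀ x} :=
    nullMeasurableSet_le aemeasurable_const h0.1.aemeasurable
  obtain ⟨R, hR⟩ := hk.exists_convolution_lt hD hbdd hℓ hG0
  obtain ⟨r, hr⟩ := hbdd.exists_norm_le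
  refine ⟨max 1 (max R (r + 1)), by positivity, fun d hd γ h t ht x hx => ?_⟩
  rw [mem_ball_zero_iff]
  by_contra! hnorm
  obtain ⟨-, hxR, hxr⟩ : 1 ≤ ‖x‖ ∧ R ≤ ‖x‖ ∧ r + 1 ≤ ‖x‖ := by
    simpa only [max_le_iff] using hnorm
  have hx0 : γ₀ x < 0 := not_le.1 fun hmem => by linarith [hr x hmem]
  exact (hR _ (h.isHeatProfile_accumulatedHeat hd hk.toIsDensity h0 hpos
    (hG.mono fun _ => (le_abs_self _).trans) hneg ht) x hxR).not_ge
    (h.le_convolution_of_mem_region hd.le hk.toIsDensity h0 hneg ht hx hx0)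

lemma IsOnePhaseInitialData.le_neg_of_neg {n : ℕ} {Ω₀ : Set (E n)} {ℓ₀ : ℝ} {γ₀ : E n → ℝ}
    (h : IsOnePhaseInitialData Ω₀ ℓ₀ γ₀) {x : E n} (hx : γ₀ x < 0) : γ₀ x ≤ -ℓ₀ :=
  (h.eq_outside x fun hmem => (h.nonneg_inside x hmem).not_gt hx).le

lemma IsOnePhaseInitialData.mem_closure_of_nonneg {n : ℕ} {Ω₀ : Set (E n)} {ℓ₀ : ℝ}
    {γ₀ : E n → ℝ} (h : IsOnePhaseInitialData Ω₀ ℓ₀ γ₀) (hℓ₀ : 0 < ℓ₀) {x : E n}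
    (hx : 0 ≤ γ₀ x) : x ∈ closure Ω₀ := by
  by_contra hmem
  linarith [h.eq_outside x hmem]

end NonlocalStefan

open NonlocalStefan in
theorem theorem1p5_general {n : ℕ} {k : E n → ℝ} (hk : IsSpreadingKernel k volume)
    {γ₀ : E n → ℝ} (h0 : MemLp γ₀ ⊤ volume) {ℓ : ℝ} (hℓ : 0 < ℓ)
    (hneg : ∀ x, γ₀ x < 0 → γ₀ x ≤ -ℓ) (hbdd : Bornology.IsBounded {x | 0 ≤ γ₀ x}) :
    (∀ (d : ℝ) (γ : ℝ → E n → ℝ), 0 < d → IsSolution d k γ₀ γ →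
      (∃ t₀ : ℝ, 0 < t₀ ∧ ∀ t, 0 ≤ t → t ≤ t₀ → region γ t = region γ 0) ∧
      (∀ t₁ t₂ : ℝ, 0 < t₁ → t₁ < t₂ → region γ t₁ ⊆ region γ t₂)) ∧
    (∃ R : ℝ, 0 < R ∧ ∀ (d : ℝ) (γ : ℝ → E n → ℝ), 0 < d → IsSolution d k γ₀ γ →
      ∀ t : ℝ, 0 < t → region γ t ⊆ Metric.ball 0 R) := by
  refine ⟨fun d γ hd h => ⟨h.exists_region_eq hd hk.toIsDensity h0 hℓ hneg, fun t₁ t₂ h₁ h₁₂ =>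
    h.region_mono hd.le hk.nonneg h₁.le h₁₂.le⟩, ?_⟩
  obtain ⟨R, hR, hsub⟩ := exists_region_subset_ball hk h0 hℓ hneg hbdd
  exact ⟨R, hR, fun d γ hd h t ht => hsub d hd γ h t ht.le⟩

theorem theorem1p5 {n : ℕ} (k : NonlocalStefan.E n → ℝ) (hk : NonlocalStefan.IsKernel k)
    (Ω₀ : Set (NonlocalStefan.E n)) (hΩ₀ : NonlocalStefan.IsSmoothBoundedDomain Ω₀)
    (ℓ₀ : ℝ) (hℓ₀ : 0 < ℓ₀)
    (γ₀ : NonlocalStefan.E n → ℝ) (hγ₀ : NonlocalStefan.IsOnePhaseInitialData Ω₀ ℓ₀ γ₀)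
    (hcont : ContinuousOn γ₀ (closure Ω₀)) :
    (∀ (d : ℝ) (γ : ℝ → NonlocalStefan.E n → ℝ), 0 < d →
      NonlocalStefan.IsSolution d k γ₀ γ →
        (∃ t₀ : ℝ, 0 < t₀ ∧ ∀ t, 0 ≤ t → t ≤ t₀ →
          NonlocalStefan.region γ t = NonlocalStefan.region γ 0) ∧
        (∀ t₁ t₂ : ℝ, 0 < t₁ → t₁ < t₂ →
          NonlocalStefan.region γ t₁ ⊆ NonlocalStefan.region γ t₂)) ∧
    (∃ R : ℝ, 0 < R ∧ ∀ (d : ℝ) (γ : ℝ → NonlocalStefan.E n → ℝ), 0 < d →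
      NonlocalStefan.IsSolution d k γ₀ γ →
        ∀ t : ℝ, 0 < t → NonlocalStefan.region γ t ⊆ Metric.ball 0 R) :=
  theorem1p5_general hk.isSpreadingKernel hγ₀.memLp_top hℓ₀ (fun _ => hγ₀.le_neg_of_neg)
    (hΩ₀.isBounded.closure.subset fun _ => hγ₀.mem_closure_of_nonneg hℓ₀)
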